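/- All graphs are finite and simple. For positive integers $a,b$, a graph $G$ is $(a,b)$-choosable if for every assignment $L$ of a set $L(v)$ of $a$ integers to each vertex $v$ of $G$ there are $b$-element sets $S(v)\subseteq L(v)$ with $S(u)\cap S(v)=\emptyset$ whenever $u$ and $v$ are adjacent. For a real number $r$, $G$ is strongly fractional $r$-choosable if it is $(a,b)$-choosable for all positive integers $a,b$ with $a/b\ge r$. The strong fractional choice number of $G$ is $$ch^s_f(G)=\inf\{r\in\mathbb{R}: G\text{ is strongly fractional } r\text{-choosable}\},$$ and for a family $\mathcal{G}$ of graphs $ch^s_f(\mathcal{G})=\sup\{ch^s_f(G):G\in\mathcal{G}\}$ (infimum and supremum in the extended reals). Let $\mathcal{P}_4$ be the family of planar graphs containing no cycle of length $4$ as a (not necessarily induced) subgraph. For every positive integer $m$ there is a graph $G\in\mathcal{P}_4$ that is not $\left(3m+\left\lfloor\frac{m-1}{2}\right\rfloor,\,m\right)$-choosable. Consequently, $$3+\tfrac12\le ch^s_f(\mathcal{P}_4)\le 4 .$$ -/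

import Mathlib

namespace StrongChoice

/-! ### Multiple list colouring -/

section Colouring

variable {V : Type*}

/-- `S` is a `b`-fold colouring of `G` from the lists `L`: each `S v` is a set of `b` colours
taken from `L v`, and adjacent vertices receive disjoint sets. -/
def IsFoldListColouring (G : SimpleGraph V) (L : V → Finset ℤ) (b : ℕ) (S : V → Finset ℤ) : Prop :=
  (∀ v, S v ⊆ L v) ∧ (∀ v, (S v).card = b) ∧ ∀ u v, G.Adj u v → Disjoint (S u) (S v)

/-- `G` is `(a, b)`-choosable: for every assignment of a set `L v` of exactly `a` integers to each
vertex `v`, there is a `b`-fold colouring of `G` from the lists `L`. -/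
def Choosable (G : SimpleGraph V) (a b : ℕ) : Prop :=
  ∀ L : V → Finset ℤ, (∀ v, (L v).card = a) → ∃ S : V → Finset ℤ, IsFoldListColouring G L b S

/-- `G` is strongly fractional `r`-choosable: it is `(a, b)`-choosable for all positive integers
`a`, `b` with `a / b ≥ r`. -/
def StronglyFractionalChoosable (G : SimpleGraph V) (r : ℝ) : Prop :=
  ∀ a b : ℕ, 0 < a → 0 < b → r ≤ (a : ℝ) / (b : ℝ) → Choosable G a b

/-- The strong fractional choice number of `G`, the infimum of all reals `r` such that `G` is
strongly fractional `r`-choosable. The infimum is taken in the extended reals, so that no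
convention for empty or unbounded sets of reals interferes. -/
noncomputable def strongFractionalChoiceNumber (G : SimpleGraph V) : EReal :=
  sInf ((fun r : ℝ => (r : EReal)) '' {r : ℝ | StronglyFractionalChoosable G r})

end Colouring

/-! ### Planar graphs, through embeddings in the sphere described by rotation systems -/

section Planar

variable {V : Type*}

/-- A rotation system of `G`: a permutation of the darts (directed edges) of `G` that, at each
vertex, permutes the darts leaving this vertex in a single cycle. It records the cyclic order in
which the edges leave each vertex, and so describes a cellular embedding of every connected
component of `G` in an oriented closed surface. -/
structure RotationSystem (G : SimpleGraph V) where
  /-- the next dart around the initial vertex -/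
  next : Equiv.Perm G.Dart
  fst_next : ∀ d, (next d).fst = d.fst
  sameCycle : ∀ d e : G.Dart, d.fst = e.fst → next.SameCycle d e

/-- Reversal of darts. -/
def dartReversal (G : SimpleGraph V) : Equiv.Perm G.Dart where
  toFun := SimpleGraph.Dart.symm
  invFun := SimpleGraph.Dart.symm
  left_inv := SimpleGraph.Dart.symm_symm
  right_inv := SimpleGraph.Dart.symm_symm

/-- The face permutation: after traversing the dart `d`, continue along the dart that follows the
reversal of `d` in the rotation at the end of `d`. Its cycles are the boundary walks of the
faces. -/
def RotationSystem.facePerm {G : SimpleGraph V} (R : RotationSystem G) : Equiv.Perm G.Dart :=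
  (dartReversal G).trans R.next

/-- The faces of a rotation system, each connected component being embedded in a surface of its
own: the cycles of the face permutation, together with one face for each isolated vertex (which
has no darts, and is embedded in a sphere with a single face). -/
def RotationSystem.Face {G : SimpleGraph V} (R : RotationSystem G) : Type _ :=
  Quotient (Equiv.Perm.SameCycle.setoid R.facePerm) ⊕ {v : V // ∀ w, ¬ G.Adj v w}

/-- A finite graph is planar if it has a rotation system all of whose components are embedded in
a sphere. Component by component one has `|V| - |E| + |F| = 2 - 2 g` with genus `g ≥ 0`, so all the
genera vanish if and only if `|V| - |E| + |F|` is twice the number of components. -/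
def Planar [Finite V] (G : SimpleGraph V) : Prop :=
  ∃ R : RotationSystem G,
    Nat.card V + Nat.card R.Face = Nat.card G.edgeSet + 2 * Nat.card G.ConnectedComponent

/-- `G` has no cycle of length `k` (as a subgraph, induced or not). -/
def NoCycleOfLength (G : SimpleGraph V) (k : ℕ) : Prop :=
  ∀ (v : V) (p : G.Walk v v), p.IsCycle → p.length ≠ k

end Planar

/-! ### Families of graphs -/

/-- A finite simple graph. -/
structure FinGraph where
  V : Type
  [finite : Finite V]
  graph : SimpleGraph V

attribute [instance] FinGraph.finite

/-- The strong fractional choice number of a family of graphs: the supremum of the strong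
fractional choice numbers of its members. -/
noncomputable def familyStrongFractionalChoiceNumber (𝒢 : Set FinGraph) : EReal :=
  sSup ((fun G : FinGraph => strongFractionalChoiceNumber G.graph) '' 𝒢)

/-- The family of planar graphs without cycles of length `k`. -/
def planarWithoutCycle (k : ℕ) : Set FinGraph :=
  {G | Planar G.graph ∧ NoCycleOfLength G.graph k}

end StrongChoice

/-! Upper bound. It suffices that a planar graph without 4-cycles is `(a, b)`-choosable whenever `4
* b ≤ a` (`Planar.choosable`). Colour the induced subgraphs by induction on the vertex set `W`. A
vertex with at most three neighbours in `W` can be coloured last. If there is none, some pentagon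
and triangle share an edge and all six of their vertices have exactly four neighbours in `W`
(`exists_lightConfiguration`), and every colouring of the rest extends to these six
(`LightConfiguration.exists_colouring`).

The configuration is found by discharging. Give a vertex its degree minus 4 and a face its length
minus 4; the total is -4 times the Euler characteristic, hence negative. There are no faces of
length 4, and two triangles never share an edge. Each triangle takes 1/3 across each of its edges.
Faces of length at least 6 can afford this; a pentagon falls short only if it has four or five
triangular neighbours. The missing charge comes from the vertices of degree at least 5 on the
pentagon or, if there are none, from the apexes of the neighbouring triangles, which have degree at
least 5 when the configuration is absent. `sum_pay_le` shows that the vertices can pay, a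
contradiction.

The topology is that of pairs of permutations of the darts. Deleting edges never lowers
`eulerExcess` (`exists_restriction`). Deleting all of them shows that the genus is not negative;
deleting those outside `W` shows that what remains has positive Euler characteristic
(`exists_submap`).

Lower bound. Two terminals share a list, and for every pair of `m`-sets that they might receive
there is a gadget that excludes this pair. A gadget is two triangles `x y w` whose vertices `w` are
adjacent. Once `x` and `y` are barred from the terminals' colours, they use up so much of a common
set `X` that both `w` need more than half of the same `m` further colours (`exists_not_choosable`).
Odd `m` gives ratios tending to 7/2. -/

namespace StrongChoice

/-! ### Counting the cycles of permutations -/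

section Setoid

variable {D : Type*}

/-- The setoid obtained from `r` by uniting the classes of `x` and `y`. -/
def joinClasses (r : Setoid D) (x y : D) : Setoid D where
  r a b := r a b ∨ (r a x ∧ r y b) ∨ (r a y ∧ r x b)
  iseqv :=
    { refl := fun a => Or.inl (r.refl a)
      symm := by
        rintro a b (h | ⟨h, h'⟩ | ⟨h, h'⟩)
        · exact Or.inl (r.symm h)
        · exact Or.inr (Or.inr ⟨r.symm h', r.symm h⟩)
        · exact Or.inr (Or.inl ⟨r.symm h', r.symm h⟩)
      trans := by
        rintro a b c (h | ⟨h, h'⟩ | ⟨h, h'⟩) (k | ⟨k, k'⟩ | ⟨k, k'⟩)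
        · exact Or.inl (r.trans h k)
        · exact Or.inr (Or.inl ⟨r.trans h k, k'⟩)
        · exact Or.inr (Or.inr ⟨r.trans h k, k'⟩)
        · exact Or.inr (Or.inl ⟨h, r.trans h' k⟩)
        · exact Or.inr (Or.inl ⟨h, k'⟩)
        · exact Or.inl (r.trans h k')
        · exact Or.inr (Or.inr ⟨h, r.trans h' k⟩)
        · exact Or.inl (r.trans h k')
        · exact Or.inr (Or.inr ⟨h, k'⟩) }

lemma le_joinClasses (r : Setoid D) (x y : D) : r ≤ joinClasses r x y :=
  fun _ _ h => Or.inl h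

lemma joinClasses_rel (r : Setoid D) (x y : D) : joinClasses r x y x y :=
  Or.inr (Or.inl ⟨r.refl x, r.refl y⟩)

lemma joinClasses_le {r t : Setoid D} {x y : D} (h : r ≤ t) (hxy : t x y) :
    joinClasses r x y ≤ t := by
  rintro a b (k | ⟨k, k'⟩ | ⟨k, k'⟩)
  · exact h k
  · exact t.trans (h k) (t.trans hxy (h k'))
  · exact t.trans (h k) (t.trans (t.symm hxy) (h k'))

lemma joinClasses_eq_self {r : Setoid D} {x y : D} (h : r x y) : joinClasses r x y = r :=
  le_antisymm (joinClasses_le le_rfl h) (le_joinClasses r x y)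

lemma joinClasses_of_singleton {r : Setoid D} {x y a b : D} (hx : ∀ c, r c x → c = x)
    (ha : a ≠ x) (hb : b ≠ x) (h : joinClasses r x y a b) : r a b := by
  rcases h with k | ⟨k, _⟩ | ⟨_, k'⟩
  · exact k
  · exact absurd (hx _ k) ha
  · exact absurd (hx _ (r.symm k')) hb

/-- The number of classes of a setoid. -/
noncomputable def numClasses (r : Setoid D) : ℕ := Nat.card (Quotient r)

variable [Finite D]

lemma numClasses_anti {r t : Setoid D} (h : r ≤ t) : numClasses t ≤ numClasses r := by
  refine Nat.card_le_card_of_surjective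
    (Quotient.map' (s₁ := r) (s₂ := t) id fun a b k => h k) ?_
  intro q
  induction q using Quotient.inductionOn with
  | h a => exact ⟨Quotient.mk r a, rfl⟩

lemma numClasses_joinClasses {r : Setoid D} {x y : D} (h : ¬ r x y) :
    numClasses (joinClasses r x y) + 1 = numClasses r := by
  classical
  have e : {q : Quotient r // q ≠ Quotient.mk r x} ≃ Quotient (joinClasses r x y) := by
    refine Equiv.ofBijective (fun q => Quotient.map' (s₁ := r) (s₂ := joinClasses r x y) id
      (fun a b k => Or.inl k) q.1) ⟨?_, ?_⟩
    · rintro ⟨p, hp⟩ ⟨q, hq⟩ hpq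
      induction p using Quotient.inductionOn with
      | h a =>
      induction q using Quotient.inductionOn with
      | h b =>
      have hax : ¬ r a x := fun k => hp (Quotient.sound k)
      have hbx : ¬ r b x := fun k => hq (Quotient.sound k)
      have hab : joinClasses r x y a b := Quotient.exact hpq
      rcases hab with k | ⟨k, _⟩ | ⟨_, k⟩
      · exact Subtype.ext (Quotient.sound k)
      · exact absurd k hax
      · exact absurd (r.symm k) hbx
    · intro q
      induction q using Quotient.inductionOn with
      | h a =>
      by_cases hax : r a x
      · refine ⟨⟨Quotient.mk r y, fun k => h (r.symm (Quotient.exact k))⟩, ?_⟩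
        exact Quotient.sound (Or.inr (Or.inr ⟨r.refl y, r.symm hax⟩))
      · exact ⟨⟨Quotient.mk r a, fun k => hax (Quotient.exact k)⟩, rfl⟩
  have h1 := Nat.card_congr e
  have := Fintype.ofFinite (Quotient r)
  rw [numClasses, numClasses, ← h1, Nat.card_eq_fintype_card, Nat.card_eq_fintype_card,
    Fintype.card_subtype_compl, Fintype.card_subtype_eq]
  have : 0 < Fintype.card (Quotient r) := Fintype.card_pos_iff.2 ⟨Quotient.mk r x⟩
  omega

lemma numClasses_le_joinClasses (r : Setoid D) (x y : D) :
    numClasses r ≤ numClasses (joinClasses r x y) + 1 := by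
  by_cases h : r x y
  · rw [joinClasses_eq_self h]; omega
  · exact (numClasses_joinClasses h).ge

end Setoid

section Perm

open Equiv Equiv.Perm

variable {D : Type*}

/-- The cycles of a permutation, fixed points included. -/
abbrev cycles (π : Perm D) : Setoid D := SameCycle.setoid π

lemma cycles_apply (π : Perm D) (a : D) : cycles π a (π a) :=
  sameCycle_apply_right.2 (SameCycle.refl _ _)

lemma cycles_le_iff {π : Perm D} {t : Setoid D} : cycles π ≤ t ↔ ∀ a, t a (π a) := by
  refine ⟨fun h a => h (cycles_apply π a), fun h => ?_⟩
  have key : ∀ (n : ℕ) (a : D), t a ((π ^ n) a) := by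
    intro n
    induction n with
    | zero => intro a; exact t.refl a
    | succ n ih =>
      intro a
      rw [pow_succ', Perm.mul_apply]
      exact t.trans (ih a) (h _)
  rintro a b ⟨n, rfl⟩
  rcases n with n | n
  · simpa using key n a
  · have := key (n + 1) ((π ^ (Int.negSucc n)) a)
    rw [← Perm.mul_apply] at this
    rw [zpow_negSucc] at this ⊢
    rw [mul_inv_cancel, Perm.one_apply] at this
    exact t.symm this

lemma eq_of_cycles_of_fixed {π : Perm D} {x c : D} (hx : π x = x) (h : cycles π c x) : c = x :=
  SameCycle.eq_of_right h hx

lemma cycles_mul_le {σ α : Perm D} {t : Setoid D} (h : cycles σ ≤ t) (h' : cycles α ≤ t) :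
    cycles (σ * α) ≤ t :=
  cycles_le_iff.2 fun a => t.trans (cycles_le_iff.1 h' a) (cycles_le_iff.1 h (α a))

variable [DecidableEq D]

lemma cycles_swap_le {t : Setoid D} {x y : D} (h : t x y) : cycles (swap x y) ≤ t := by
  refine cycles_le_iff.2 fun a => ?_
  by_cases hx : a = x
  · subst hx; simpa using h
  by_cases hy : a = y
  · subst hy; simpa using t.symm h
  rw [swap_apply_of_ne_of_ne hx hy]

lemma cycles_mul_swap_le (π : Perm D) (x y : D) :
    cycles (π * swap x y) ≤ joinClasses (cycles π) x y :=
  cycles_mul_le (le_joinClasses _ _ _) (cycles_swap_le (joinClasses_rel _ _ _))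

variable [Finite D]

/-- The new permutation sends `x` to `π y` and then follows the old cycle of `y`, which avoids `x`,
until it arrives at `y`. -/
lemma sameCycle_mul_swap {π : Perm D} {x y : D} (h : ¬ SameCycle π x y) :
    SameCycle (π * swap x y) x y := by
  have key : ∀ k : ℕ, SameCycle (π * swap x y) x ((π ^ (k + 1)) y) := by
    intro k
    induction k with
    | zero =>
      have : (π * swap x y) x = π y := by simp
      rw [zero_add, pow_one, ← this, sameCycle_apply_right]
    | succ k ih =>
      set w := (π ^ (k + 1)) y with hw
      have hstep : (π ^ (k + 1 + 1)) y = π w := by rw [pow_succ', Perm.mul_apply]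
      rw [hstep]
      by_cases hwy : w = y
      · have : (π * swap x y) x = π w := by simp [hwy]
        rw [← this, sameCycle_apply_right]
      · have hwx : w ≠ x := by
          intro hwx
          exact h (SameCycle.symm ⟨(k + 1 : ℕ), by rw [zpow_natCast, ← hw, hwx]⟩)
        have : (π * swap x y) w = π w := by
          rw [Perm.mul_apply, swap_apply_of_ne_of_ne hwx hwy]
        rwa [← this, sameCycle_apply_right]
  have hpos := orderOf_pos π
  have := key (orderOf π - 1)
  rwa [Nat.sub_add_cancel hpos, pow_orderOf_eq_one] at this

lemma cycles_mul_swap {π : Perm D} {x y : D} (h : ¬ SameCycle π x y) :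
    cycles (π * swap x y) = joinClasses (cycles π) x y := by
  refine le_antisymm (cycles_mul_swap_le π x y) (joinClasses_le ?_ (sameCycle_mul_swap h))
  have hxy : cycles (π * swap x y) x y := sameCycle_mul_swap h
  have hπ : π = π * swap x y * swap x y := by rw [mul_assoc, swap_mul_self, mul_one]
  calc cycles π = cycles (π * swap x y * swap x y) := by rw [← hπ]
    _ ≤ _ := cycles_mul_le le_rfl (cycles_swap_le hxy)

/-- The number of cycles of a permutation, fixed points included. -/
noncomputable abbrev numCycles (π : Perm D) : ℕ := numClasses (cycles π)

lemma numCycles_mul_swap {π : Perm D} {x y : D} (h : ¬ SameCycle π x y) :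
    numCycles (π * swap x y) + 1 = numCycles π := by
  rw [numCycles, cycles_mul_swap h, numClasses_joinClasses h]

lemma numCycles_le_mul_swap (π : Perm D) (x y : D) :
    numCycles π ≤ numCycles (π * swap x y) + 1 :=
  (numClasses_le_joinClasses _ x y).trans
    (Nat.add_le_add_right (numClasses_anti (cycles_mul_swap_le π x y)) 1)

/-- The Euler characteristic of the combinatorial map with rotation `σ` and dart reversal `α`,
minus twice its number of components. Fixed points of `α` are allowed. -/
noncomputable def eulerExcess (σ α : Perm D) : ℤ :=
  numCycles σ + numCycles α + numCycles (σ * α) - Nat.card D - 2 * numClasses (cycles σ ⊔ cycles α)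

/-- Unlinking an edge adds one cycle to `α`. If its two darts stay in one component, at most one
face is lost. Otherwise a face splits in two, which together with the new cycle of `α` pays for the
one component that may be gained. -/
lemma eulerExcess_le_unlink {σ α : Perm D} {x : D} (hx : α x ≠ x) (hxx : α (α x) = x) :
    eulerExcess σ α ≤ eulerExcess σ (α * swap x (α x)) := by
  set y := α x with hy
  set α' := α * swap x y with hα'
  have hα : α = α' * swap x y := by rw [hα', mul_assoc, swap_mul_self, mul_one]
  have hφ : σ * α = σ * α' * swap x y := by rw [mul_assoc, ← hα]
  have hα'x : α' x = x := by simp [hα', hxx]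
  have h1 : numCycles α + 1 = numCycles α' := by
    rw [hα]
    exact numCycles_mul_swap fun h => hx (eq_of_cycles_of_fixed hα'x h.symm)
  have hle : cycles α ≤ joinClasses (cycles σ ⊔ cycles α') x y := by
    rw [hα]
    exact cycles_mul_le (le_sup_right.trans (le_joinClasses _ _ _))
      (cycles_swap_le (joinClasses_rel _ _ _))
  have hsup : cycles σ ⊔ cycles α ≤ joinClasses (cycles σ ⊔ cycles α') x y :=
    sup_le (le_sup_left.trans (le_joinClasses _ _ _)) hle
  unfold eulerExcess
  by_cases hxy : (cycles σ ⊔ cycles α') x y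
  · rw [joinClasses_eq_self hxy] at hsup
    have h2 := numClasses_anti hsup
    have h3 : numCycles (σ * α) ≤ numCycles (σ * α') + 1 := by
      have := numCycles_le_mul_swap (σ * α) x y
      rwa [hφ, mul_assoc (σ * α'), swap_mul_self, mul_one, ← hφ] at this
    omega
  · have h2 := numClasses_anti hsup
    have h4 := numClasses_joinClasses hxy
    have h3 : numCycles (σ * α) + 1 = numCycles (σ * α') := by
      rw [hφ]
      exact numCycles_mul_swap fun h => hxy (cycles_mul_le le_sup_left le_sup_right h)
    omega

/-- Cut the point `x` out of its cycle. -/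
def cutOut (σ : Perm D) (x : D) : Perm D := σ * swap x (σ.symm x)

omit [Finite D] in
lemma cutOut_self (σ : Perm D) (x : D) : cutOut σ x x = x := by simp [cutOut]

omit [Finite D] in
lemma cutOut_mul_swap (σ : Perm D) (x : D) : cutOut σ x * swap x (σ.symm x) = σ := by
  rw [cutOut, mul_assoc, swap_mul_self, mul_one]

omit [Finite D] in
lemma cutOut_eq_self {σ : Perm D} {x : D} (h : σ x = x) : cutOut σ x = σ := by
  have : σ.symm x = x := by rw [Equiv.symm_apply_eq, h]
  rw [cutOut, this, swap_self]
  exact mul_one σ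

omit [Finite D] in
lemma cutOut_apply_fixed {σ : Perm D} {x z : D} (h : σ z = z) : cutOut σ x z = z := by
  by_cases hzx : z = x
  · rw [hzx, cutOut_self]
  · have : z ≠ σ.symm x := by
      intro hz
      apply hzx
      rw [← h, hz, Equiv.apply_symm_apply]
    rw [cutOut, Perm.mul_apply, swap_apply_of_ne_of_ne hzx this, h]

omit [Finite D] in
lemma cycles_cutOut_le (σ : Perm D) (x : D) : cycles (cutOut σ x) ≤ cycles σ :=
  cycles_mul_le le_rfl (cycles_swap_le (Setoid.symm' _
    (sameCycle_symm_apply_left.2 (SameCycle.refl _ _))))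

omit [Finite D] in
lemma not_sameCycle_cutOut {σ : Perm D} {x : D} (h : σ x ≠ x) :
    ¬ SameCycle (cutOut σ x) x (σ.symm x) := by
  intro k
  have := eq_of_cycles_of_fixed (cutOut_self σ x) k.symm
  exact h (by rw [Equiv.symm_apply_eq] at this; exact this.symm)

lemma numCycles_cutOut {σ : Perm D} {x : D} (h : σ x ≠ x) :
    numCycles (cutOut σ x) = numCycles σ + 1 := by
  have := numCycles_mul_swap (not_sameCycle_cutOut h)
  rw [cutOut_mul_swap] at this
  exact this.symm

lemma sameCycle_cutOut {σ : Perm D} {x a b : D} (ha : a ≠ x) (hb : b ≠ x)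
    (h : SameCycle σ a b) : SameCycle (cutOut σ x) a b := by
  by_cases hx : σ x = x
  · rwa [cutOut_eq_self hx]
  · have key := cycles_mul_swap (not_sameCycle_cutOut hx)
    rw [cutOut_mul_swap] at key
    have h' : cycles σ a b := h
    rw [key] at h'
    exact joinClasses_of_singleton (fun c hc => eq_of_cycles_of_fixed (cutOut_self σ x) hc) ha hb h'

/-- As `α` fixes `x`, cutting `x` out of `σ` also cuts it out of `σ * α`. Unless `x` is fixed
already, both gain a cycle, and at most one component is gained. -/
lemma eulerExcess_le_cutOut {σ α : Perm D} {x : D} (hα : α x = x) :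
    eulerExcess σ α ≤ eulerExcess (cutOut σ x) α := by
  by_cases hx : σ x = x
  · rw [cutOut_eq_self hx]
  have hφx : (σ * α) x ≠ x := by simpa [hα] using hx
  have hφ : cutOut σ x * α = cutOut (σ * α) x := by
    have hαx : α.symm x = x := by rw [Equiv.symm_apply_eq, hα]
    have hs : α * swap x ((σ * α).symm x) = swap x (σ.symm x) * α := by
      have := swap_mul_eq_mul_swap α x (σ.symm x)
      rw [this, ← Perm.inv_def, ← Perm.inv_def]
      have e1 : α⁻¹ x = x := hαx
      rw [e1, mul_inv_rev]
      rfl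
    rw [cutOut, cutOut, mul_assoc, mul_assoc, hs]
  have h1 := numCycles_cutOut hx
  have h2 := numCycles_cutOut hφx
  rw [← hφ] at h2
  have hsup : cycles σ ⊔ cycles α ≤
      joinClasses (cycles (cutOut σ x) ⊔ cycles α) x (σ.symm x) := by
    refine sup_le ?_ (le_sup_right.trans (le_joinClasses _ _ _))
    conv_lhs => rw [← cutOut_mul_swap σ x]
    exact cycles_mul_le (le_sup_left.trans (le_joinClasses _ _ _))
      (cycles_swap_le (joinClasses_rel _ _ _))
  have h3 := numClasses_anti hsup
  have h4 := numClasses_le_joinClasses (cycles (cutOut σ x) ⊔ cycles α) x (σ.symm x)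
  unfold eulerExcess
  omega

/-- Deleting all edges of a combinatorial map outside of a set `L` of darts does not decrease the
Euler excess. -/
lemma exists_restriction {σ α : Perm D} (hα : ∀ d, α (α d) = d) (hα' : ∀ d, α d ≠ d)
    (L : Set D) (hL : ∀ d ∈ L, α d ∈ L) :
    ∃ σ' α' : Perm D, (∀ d ∈ L, α' d = α d) ∧ (∀ d ∉ L, α' d = d) ∧ (∀ d ∉ L, σ' d = d) ∧
      cycles σ' ≤ cycles σ ∧ (∀ d ∈ L, ∀ e ∈ L, SameCycle σ d e → SameCycle σ' d e) ∧
      eulerExcess σ α ≤ eulerExcess σ' α' := by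
  induction hn : Lᶜ.ncard using Nat.strong_induction_on generalizing L with
  | _ n ih =>
  by_cases hne : Lᶜ.Nonempty
  · obtain ⟨x, hx⟩ := hne
    have hx' : x ∉ L := hx
    have hax : α x ∉ L := fun h => hx' (by simpa [hα] using hL _ h)
    -- The edge of `x` is the last to go: first everything outside `L ∪ {x, α x}` is deleted, then
    -- this edge is unlinked and its two darts are cut out.
    obtain ⟨σ₁, α₁, h1, h2, h3, h4, h5, h6⟩ := ih (L ∪ {x, α x})ᶜ.ncard
      (by
        rw [← hn]
        refine Set.ncard_lt_ncard ⟨?_, ?_⟩ (Set.toFinite _)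
        · intro d hd hdL
          exact hd (Or.inl hdL)
        · intro h
          exact h hx' (Or.inr (by simp)))
      (L ∪ {x, α x})
      (by
        rintro d (hd | hd | hd)
        · exact Or.inl (hL d hd)
        · rw [hd]; exact Or.inr (by simp)
        · rw [hd, hα]; exact Or.inr (by simp)) rfl
    have hα₁x : α₁ x = α x := h1 x (Or.inr (by simp))
    have hα₁y : α₁ (α x) = x := by rw [h1 (α x) (Or.inr (by simp)), hα]
    set α₂ := α₁ * swap x (α x) with hα₂
    have hα₂x : α₂ x = x := by simp [hα₂, hα₁y]
    have hα₂y : α₂ (α x) = α x := by simp [hα₂, hα₁x]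
    have hα₂o : ∀ d, d ≠ x → d ≠ α x → α₂ d = α₁ d := fun d hd hd' => by
      rw [hα₂, Perm.mul_apply, swap_apply_of_ne_of_ne hd hd']
    have hne : ∀ d ∈ L, d ≠ x ∧ d ≠ α x := fun d hd =>
      ⟨fun h => hx' (h ▸ hd), fun h => hax (h ▸ hd)⟩
    have hdead : ∀ d ∉ L, d = x ∨ d = α x ∨ d ∉ L ∪ {x, α x} := by
      intro d hd
      by_cases h : d = x
      · exact Or.inl h
      by_cases h' : d = α x
      · exact Or.inr (Or.inl h')
      exact Or.inr (Or.inr (by simp [hd, h, h']))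
    refine ⟨cutOut (cutOut σ₁ x) (α x), α₂, ?_, ?_, ?_, ?_, ?_, ?_⟩
    · intro d hd
      rw [hα₂o d (hne d hd).1 (hne d hd).2, h1 d (Or.inl hd)]
    · intro d hd
      by_cases hdx : d = x
      · rw [hdx, hα₂x]
      by_cases hdy : d = α x
      · rw [hdy, hα₂y]
      rw [hα₂o d hdx hdy, h2 d (by simp [hd, hdx, hdy])]
    · intro d hd
      rcases hdead d hd with h | h | h
      · rw [h]; exact cutOut_apply_fixed (cutOut_self _ _)
      · rw [h, cutOut_self]
      · exact cutOut_apply_fixed (cutOut_apply_fixed (h3 d h))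
    · exact (cycles_cutOut_le _ _).trans ((cycles_cutOut_le _ _).trans h4)
    · intro d hd e he hde
      exact sameCycle_cutOut (hne d hd).2 (hne e he).2
        (sameCycle_cutOut (hne d hd).1 (hne e he).1 (h5 d (Or.inl hd) e (Or.inl he) hde))
    · have e1 : eulerExcess σ₁ α₁ ≤ eulerExcess σ₁ α₂ := by
        have := eulerExcess_le_unlink (σ := σ₁) (α := α₁) (x := x) (by rw [hα₁x]; exact hα' x)
          (by rw [hα₁x, hα₁y])
        rwa [hα₁x] at this
      exact h6.trans (e1.trans ((eulerExcess_le_cutOut hα₂x).trans (eulerExcess_le_cutOut hα₂y)))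
  · have hall : ∀ d, d ∈ L := fun d => by
      by_contra h
      exact hne ⟨d, h⟩
    exact ⟨σ, α, fun _ _ => rfl, fun d hd => absurd (hall d) hd, fun d hd => absurd (hall d) hd,
      le_rfl, fun _ _ _ _ h => h, le_rfl⟩

/-- Euler's inequality: the genus of a combinatorial map is not negative. -/
theorem eulerExcess_nonpos {σ α : Perm D} (hα : ∀ d, α (α d) = d) (hα' : ∀ d, α d ≠ d) :
    eulerExcess σ α ≤ 0 := by
  obtain ⟨σ', α', -, h2, h3, -, -, h6⟩ := exists_restriction (σ := σ) hα hα' ∅ (by simp)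
  -- With all edges deleted every dart is a component of its own, and the excess is `3 |D| - |D| - 2
  -- |D| = 0`.
  have e1 : σ' = 1 := Equiv.ext fun d => h3 d (by simp)
  have e2 : α' = 1 := Equiv.ext fun d => h2 d (by simp)
  have hc : cycles (1 : Perm D) = ⊥ := by
    ext a b
    exact sameCycle_one
  have hb : numClasses (⊥ : Setoid D) = Nat.card D :=
    (Nat.card_congr (Equiv.ofBijective (Quotient.mk (⊥ : Setoid D))
      ⟨fun a b h => Quotient.exact h, Quotient.mk_surjective⟩)).symm
  refine h6.trans ?_
  rw [e1, e2, eulerExcess, mul_one, numCycles, hc, sup_idem, hb]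
  omega

end Perm

end StrongChoice

namespace StrongChoice

/-! ### Cycle counts as sums over darts, and submaps of maps of genus zero -/

section Period

open Equiv Equiv.Perm Function

variable {D : Type*} [Finite D]

lemma ncard_sameCycle (π : Perm D) (a : D) :
    {b | SameCycle π a b}.ncard = minimalPeriod π a := by
  classical
  have := Fintype.ofFinite D
  have h : {b | SameCycle π a b} = MulAction.orbit (Subgroup.zpowers π) a := by
    ext b
    constructor
    · rintro ⟨n, hn⟩
      exact ⟨⟨π ^ n, n, rfl⟩, hn⟩
    · rintro ⟨⟨_, n, rfl⟩, hn⟩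
      exact ⟨n, hn⟩
  have : Fintype (MulAction.orbit (Subgroup.zpowers π) a) := Fintype.ofFinite _
  have e := MulAction.minimalPeriod_eq_card (a := π) (b := a)
  rw [h, ← Nat.card_coe_set_eq, Nat.card_eq_fintype_card, ← e]
  rfl

lemma minimalPeriod_eq_of_sameCycle {π : Perm D} {a b : D} (h : SameCycle π a b) :
    minimalPeriod π a = minimalPeriod π b := by
  rw [← ncard_sameCycle, ← ncard_sameCycle]
  congr 1
  ext c
  exact ⟨fun k => h.symm.trans k, fun k => h.trans k⟩

lemma minimalPeriod_perm_pos (π : Perm D) (a : D) : 0 < minimalPeriod π a := by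
  rw [← ncard_sameCycle]
  exact (Set.ncard_pos (Set.toFinite _)).2 ⟨a, SameCycle.refl _ _⟩

/-- A cycle of length `n` consists of `n` darts of weight `1 / n`. This turns Euler's formula into a
sum over darts, the form in which charge is moved later. -/
lemma numCycles_eq_sum [Fintype D] (π : Perm D) :
    (numCycles π : ℚ) = ∑ d, 1 / (minimalPeriod π d : ℚ) := by
  classical
  have : Fintype (Quotient (cycles π)) := Fintype.ofFinite _
  rw [← Finset.sum_fiberwise (s := Finset.univ) (g := Quotient.mk (cycles π))]
  have key : ∀ q : Quotient (cycles π),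
      ∑ d with Quotient.mk (cycles π) d = q, 1 / (minimalPeriod π d : ℚ) = 1 := by
    intro q
    induction q using Quotient.inductionOn with
    | h a =>
    have h1 : ∀ d ∈ Finset.univ.filter (fun d => Quotient.mk (cycles π) d = Quotient.mk _ a),
        1 / (minimalPeriod π d : ℚ) = 1 / (minimalPeriod π a : ℚ) := by
      intro d hd
      have : SameCycle π d a := Quotient.exact (Finset.mem_filter.1 hd).2
      rw [minimalPeriod_eq_of_sameCycle this]
    have h2 : (Finset.univ.filter
        (fun d => Quotient.mk (cycles π) d = Quotient.mk _ a)).card = minimalPeriod π a := by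
      rw [← ncard_sameCycle, ← Set.ncard_coe_finset]
      congr 1
      ext d
      simp only [Finset.coe_filter, Finset.mem_univ, true_and, Set.mem_ofPred_eq]
      exact ⟨fun k => SameCycle.symm (Quotient.exact k), fun k => Quotient.sound k.symm⟩
    rw [Finset.sum_congr rfl h1, Finset.sum_const, h2, nsmul_eq_mul]
    have := minimalPeriod_perm_pos π a
    field_simp
  rw [Finset.sum_congr rfl fun q _ => key q]
  simp [numCycles, numClasses, Nat.card_eq_fintype_card]

omit [Finite D] in
lemma minimalPeriod_subtypePerm {p : D → Prop} (π : Perm D) (h : ∀ d, p (π d) ↔ p d)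
    (d : {d // p d}) : minimalPeriod (π.subtypePerm h) d = minimalPeriod π d.1 := by
  rw [minimalPeriod_eq_minimalPeriod_iff]
  intro n
  have : ∀ n : ℕ, (((π.subtypePerm h)^[n] d).1) = π^[n] d.1 := by
    intro n
    induction n with
    | zero => rfl
    | succ n ih => rw [iterate_succ_apply', iterate_succ_apply', ← ih]; rfl
  simp only [IsPeriodicPt, IsFixedPt, ← this, Subtype.ext_iff]

omit [Finite D] in
lemma minimalPeriod_involution {α : Perm D} {d : D} (h : α (α d) = d) (h' : α d ≠ d) :
    minimalPeriod α d = 2 := by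
  apply minimalPeriod_eq_prime
  · exact h
  · exact h'

/-- A nonempty submap of a map of genus zero has positive Euler characteristic; here the Euler
characteristic is written as a sum over the darts. -/
theorem exists_submap [DecidableEq D] {σ α : Perm D} (hα : ∀ d, α (α d) = d) (hα' : ∀ d, α d ≠ d)
    (hE : 0 ≤ eulerExcess σ α) (p : D → Prop) (hp : ∀ d, p (α d) ↔ p d) (hne : ∃ d, p d)
    [Fintype D] [DecidablePred p] :
    ∃ σ' α' : Perm {d // p d}, (∀ d, (α' d).1 = α d.1) ∧
      (∀ d e, SameCycle σ' d e ↔ SameCycle σ d.1 e.1) ∧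
      0 < ∑ d, (1 / (minimalPeriod σ' d : ℚ) + 1 / (minimalPeriod (σ' * α') d : ℚ) - 1 / 2) := by
  obtain ⟨σ₁, α₁, h1, h2, h3, h4, h5, h6⟩ :=
    exists_restriction (σ := σ) hα hα' {d | p d} fun d hd => (hp d).2 hd
  simp only [Set.mem_ofPred_eq] at h1 h2 h3 h5
  have hpσ : ∀ d, p (σ₁ d) ↔ p d := by
    intro d
    by_cases hd : p d
    · refine iff_of_true ?_ hd
      by_contra h
      have := σ₁.injective (h3 _ h)
      rw [this] at h
      exact h hd
    · rw [h3 d hd]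
  have hpα : ∀ d, p (α₁ d) ↔ p d := by
    intro d
    by_cases hd : p d
    · rw [h1 d hd, hp]
    · rw [h2 d hd]
  refine ⟨σ₁.subtypePerm hpσ, α₁.subtypePerm hpα, fun d => h1 d.1 d.2, ?_, ?_⟩
  · intro d e
    rw [sameCycle_subtypePerm]
    exact ⟨fun h => h4 h, fun h => h5 _ d.2 _ e.2 h⟩
  obtain ⟨d₀, hd₀⟩ := hne
  have hpm : ∀ d, p ((σ₁ * α₁) d) ↔ p d := fun d => (hpσ _).trans (hpα d)
  have hmul : σ₁.subtypePerm hpσ * α₁.subtypePerm hpα = (σ₁ * α₁).subtypePerm hpm := rfl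
  have hterm : ∀ d : {d // p d}, (1 / (minimalPeriod (σ₁.subtypePerm hpσ) d : ℚ) +
      1 / (minimalPeriod (σ₁.subtypePerm hpσ * α₁.subtypePerm hpα) d : ℚ) - 1 / 2) =
      (fun d : D => 1 / (minimalPeriod σ₁ d : ℚ) + 1 / (minimalPeriod α₁ d : ℚ)
        + 1 / (minimalPeriod (σ₁ * α₁) d : ℚ) - 1) d.1 := by
    intro d
    rw [hmul, minimalPeriod_subtypePerm, minimalPeriod_subtypePerm]
    have : minimalPeriod α₁ d.1 = 2 :=
      minimalPeriod_involution (by rw [h1 d.1 d.2, h1 _ ((hp _).2 d.2), hα])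
        (by rw [h1 d.1 d.2]; exact hα' _)
    simp only [this]
    push_cast
    ring
  rw [Finset.sum_congr rfl fun d _ => hterm d]
  have hsplit := Fintype.sum_subtype_add_sum_subtype p (fun d : D =>
    1 / (minimalPeriod σ₁ d : ℚ) + 1 / (minimalPeriod α₁ d : ℚ)
      + 1 / (minimalPeriod (σ₁ * α₁) d : ℚ) - 1)
  -- A deleted dart is fixed by all three permutations and contributes `1 + 1 + 1 - 1 = 2`, exactly
  -- twice its own component.
  have hdead : ∀ d : {d // ¬ p d}, (fun d : D => 1 / (minimalPeriod σ₁ d : ℚ) +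
      1 / (minimalPeriod α₁ d : ℚ) + 1 / (minimalPeriod (σ₁ * α₁) d : ℚ) - 1) d.1 = 2 := by
    intro d
    have e1 : minimalPeriod σ₁ d.1 = 1 := minimalPeriod_eq_one_iff_isFixedPt.2 (h3 _ d.2)
    have e2 : minimalPeriod α₁ d.1 = 1 := minimalPeriod_eq_one_iff_isFixedPt.2 (h2 _ d.2)
    have e3 : minimalPeriod (σ₁ * α₁) d.1 = 1 := minimalPeriod_eq_one_iff_isFixedPt.2
      (show σ₁ (α₁ d.1) = d.1 by rw [h2 _ d.2, h3 _ d.2])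
    simp only [e1, e2, e3]
    norm_num
  rw [Finset.sum_congr (s₁ := (Finset.univ : Finset {d // ¬ p d})) rfl fun d _ => hdead d] at hsplit
  have htotal : ∑ d : D, (1 / (minimalPeriod σ₁ d : ℚ) + 1 / (minimalPeriod α₁ d : ℚ)
      + 1 / (minimalPeriod (σ₁ * α₁) d : ℚ) - 1) =
      numCycles σ₁ + numCycles α₁ + numCycles (σ₁ * α₁) - Fintype.card D := by
    rw [numCycles_eq_sum, numCycles_eq_sum, numCycles_eq_sum, Finset.sum_sub_distrib,
      Finset.sum_add_distrib, Finset.sum_add_distrib]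
    simp
  -- Besides the deleted darts, the remaining ones form at least one more component, so their share
  -- of the sum is at least 2.
  have horb : Fintype.card {d // ¬ p d} + 1 ≤ numClasses (cycles σ₁ ⊔ cycles α₁) := by
    let t : Setoid D :=
      { r := fun a b => a = b ∨ (p a ∧ p b)
        iseqv :=
          { refl := fun a => Or.inl rfl
            symm := by
              rintro a b (h | ⟨h, h'⟩)
              · exact Or.inl h.symm
              · exact Or.inr ⟨h', h⟩
            trans := by
              rintro a b c (rfl | ⟨h, h'⟩) (rfl | ⟨k, k'⟩)
              · exact Or.inl rfl
              · exact Or.inr ⟨k, k'⟩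
              · exact Or.inr ⟨h, h'⟩
              · exact Or.inr ⟨h, k'⟩ } }
    have hσt : cycles σ₁ ⊔ cycles α₁ ≤ t := by
      refine sup_le (cycles_le_iff.2 fun a => ?_) (cycles_le_iff.2 fun a => ?_)
      · by_cases ha : p a
        · exact Or.inr ⟨ha, (hpσ a).2 ha⟩
        · exact Or.inl (h3 a ha).symm
      · by_cases ha : p a
        · exact Or.inr ⟨ha, (hpα a).2 ha⟩
        · exact Or.inl (h2 a ha).symm
    rw [← Fintype.card_option, ← Nat.card_eq_fintype_card]
    refine Nat.card_le_card_of_injective (fun o : Option {d // ¬ p d} =>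
      Quotient.mk (cycles σ₁ ⊔ cycles α₁) (o.elim d₀ Subtype.val)) ?_
    rintro (_ | a) (_ | b) hab
    · rfl
    · rcases hσt (Quotient.exact hab) with h | h
      · exact absurd (by rw [← show d₀ = b.1 from h]; exact hd₀) b.2
      · exact absurd h.2 b.2
    · rcases hσt (Quotient.exact hab) with h | h
      · exact absurd (by rw [show a.1 = d₀ from h]; exact hd₀) a.2
      · exact absurd h.1 a.2
    · rcases hσt (Quotient.exact hab) with h | h
      · exact congrArg some (Subtype.ext h)
      · exact absurd h.1 a.2
  have h7 : (0 : ℤ) ≤ eulerExcess σ₁ α₁ := hE.trans h6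
  rw [eulerExcess, Nat.card_eq_fintype_card] at h7
  have h8 : (0 : ℚ) ≤ numCycles σ₁ + numCycles α₁ + numCycles (σ₁ * α₁) - Fintype.card D
      - 2 * numClasses (cycles σ₁ ⊔ cycles α₁) := by exact_mod_cast h7
  have h9 : (Fintype.card {d // ¬ p d} : ℚ) + 1 ≤ numClasses (cycles σ₁ ⊔ cycles α₁) := by
    exact_mod_cast horb
  rw [htotal, Finset.sum_const, Finset.card_univ, nsmul_eq_mul] at hsplit
  beta_reduce
  linarith

end Period

end StrongChoice

namespace StrongChoice

/-! ### Discharging in plane maps without 4-cycles -/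

/-! ### Linear inequalities for the charge paid around a vertex of degree 5 or 6 -/

section Arithmetic

/-- The index runs over the corners at the vertex: `b` marks triangles, `δ` is paid to pentagons,
`o` through triangles. At most two corners are triangles. With two of them the bound is tight: the
corner between them and the two `o` take at most 2/3, the two adjacent corners left over at most 1/3
by `hδδ`. -/
lemma sum_charge_five (b δ o : Fin 5 → ℚ) (hb : ∀ i, b i = 0 ∨ b i = 1)
    (hbb : ∀ i, b i + b (i + 1) ≤ 1) (hδ : ∀ i, δ (i + 1) ≤ (b i + b (i + 2)) / 3)
    (hδb : ∀ i, δ i ≤ 2 / 3 * (1 - b i))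
    (hδδ : ∀ i, δ i + δ (i + 1) ≤ (1 + b i + b (i + 1)) / 3)
    (ho : ∀ i, o i ≤ 2 / 15 * b i) (hor : ∀ i, δ (i + 1) + 5 / 2 * o i ≤ 2 / 3)
    (hol : ∀ i, δ i + 5 / 2 * o (i + 1) ≤ 2 / 3) :
    ∑ i, (δ i + o i) ≤ 1 := by
  simp only [Fin.forall_fin_succ, Fin.sum_univ_five] at *
  simp only [Fin.isValue, Fin.succ_zero_eq_one, Fin.succ_one_eq_two, IsEmpty.forall_iff, and_true,
    Fin.reduceSucc, Fin.reduceAdd, zero_add] at *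
  obtain ⟨p0, p1, p2, p3, p4⟩ := hb
  obtain ⟨q0, q1, q2, q3, q4⟩ := hbb
  obtain ⟨r0, r1, r2, r3, r4⟩ := hδ
  obtain ⟨s0, s1, s2, s3, s4⟩ := hδb
  obtain ⟨t0, t1, t2, t3, t4⟩ := hδδ
  obtain ⟨u0, u1, u2, u3, u4⟩ := ho
  obtain ⟨v0, v1, v2, v3, v4⟩ := hor
  obtain ⟨w0, w1, w2, w3, w4⟩ := hol
  rcases p0 with p0 | p0 <;>
    rcases p1 with p1 | p1 <;>
    rcases p2 with p2 | p2 <;>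
    rcases p3 with p3 | p3 <;>
    rcases p4 with p4 | p4 <;>
    linarith

/-- Each triangle accounts for at most `2/3 + 2/15 = 4/5`, so two are harmless. Three triangles must
alternate with the other corners, and then each pair of neighbouring corners takes at most 2/3. -/
lemma sum_charge_six (b δ o : Fin 6 → ℚ) (hb : ∀ i, b i = 0 ∨ b i = 1)
    (hbb : ∀ i, b i + b (i + 1) ≤ 1) (hδ : ∀ i, δ (i + 1) ≤ (b i + b (i + 2)) / 3)
    (hδb : ∀ i, δ i ≤ 2 / 3 * (1 - b i))
    (ho : ∀ i, o i ≤ 2 / 15 * b i) (hor : ∀ i, δ (i + 1) + 5 / 2 * o i ≤ 2 / 3)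
    (hol : ∀ i, δ i + 5 / 2 * o (i + 1) ≤ 2 / 3) :
    ∑ i, (δ i + o i) ≤ 2 := by
  simp only [Fin.forall_fin_succ, Fin.sum_univ_six] at *
  simp only [Fin.isValue, Fin.succ_zero_eq_one, Fin.succ_one_eq_two, IsEmpty.forall_iff, and_true,
    Fin.reduceSucc, Fin.reduceAdd, zero_add] at *
  obtain ⟨p0, p1, p2, p3, p4, p5⟩ := hb
  obtain ⟨q0, q1, q2, q3, q4, q5⟩ := hbb
  obtain ⟨r0, r1, r2, r3, r4, r5⟩ := hδ
  obtain ⟨s0, s1, s2, s3, s4, s5⟩ := hδb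
  obtain ⟨u0, u1, u2, u3, u4, u5⟩ := ho
  obtain ⟨v0, v1, v2, v3, v4, v5⟩ := hor
  obtain ⟨w0, w1, w2, w3, w4, w5⟩ := hol
  by_cases ht : b 0 + b 1 + b 2 + b 3 + b 4 + b 5 ≤ 2
  · linarith
  have key : (b 1 = 0 ∧ b 3 = 0 ∧ b 5 = 0) ∨ (b 0 = 0 ∧ b 2 = 0 ∧ b 4 = 0) := by
    clear r0 r1 r2 r3 r4 r5 s0 s1 s2 s3 s4 s5 u0 u1 u2 u3 u4 u5 v0 v1 v2 v3 v4 v5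
    clear w0 w1 w2 w3 w4 w5
    rcases p1 with p1 | p1
    · refine Or.inl ⟨p1, ?_, ?_⟩
      · rcases p3 with p3 | p3
        · exact p3
        · exfalso; linarith
      · rcases p5 with p5 | p5
        · exact p5
        · exfalso; linarith
    · refine Or.inr ⟨?_, ?_, ?_⟩
      · rcases p0 with p0 | p0 <;> linarith
      · rcases p2 with p2 | p2 <;> linarith
      · rcases p4 with p4 | p4
        · exact p4
        · exfalso; linarith
  clear p0 p1 p2 p3 p4 p5
  rcases key with ⟨k1, k2, k3⟩ | ⟨k1, k2, k3⟩
  · linarith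
  · linarith

end Arithmetic

section Sums

open Equiv

variable {D : Type*} [Fintype D]

lemma sum_ite_comp (π : Perm D) {q : D → Prop} [DecidablePred q] (hq : ∀ d, q (π d) ↔ q d) (f : D → ℚ) :
    ∑ d, (if q d then f (π d) else 0) = ∑ d, (if q d then f d else 0) := by
  rw [← Equiv.sum_comp π fun d => if q d then f d else 0]
  simp only [hq]

/-- Summing over an invariant set, `f` may be replaced by its mean over `n` successive points. With
`n` the common cycle length, this reduces a global sum to a bound around one vertex or one face. -/
lemma sum_ite_average (π : Perm D) {q : D → Prop} [DecidablePred q] (hq : ∀ d, q (π d) ↔ q d)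
    (f : D → ℚ) (n : ℕ) (hn : 0 < n) :
    ∑ d, (if q d then f d else 0) =
      ∑ d, (if q d then (∑ i : Fin n, f ((π ^ (i : ℕ)) d)) / n else 0) := by
  have hpow : ∀ (k : ℕ) d, q ((π ^ k) d) ↔ q d := by
    intro k
    induction k with
    | zero => intro d; rfl
    | succ k ih => intro d; rw [pow_succ', Perm.mul_apply, hq, ih]
  have h1 : ∀ d, (if q d then (∑ i : Fin n, f ((π ^ (i : ℕ)) d)) / n else 0) =
      ∑ i : Fin n, (if q d then f ((π ^ (i : ℕ)) d) else 0) / n := by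
    intro d
    split_ifs
    · rw [Finset.sum_div]
    · simp
  rw [Finset.sum_congr rfl fun d _ => h1 d, Finset.sum_comm]
  simp only [← Finset.sum_div]
  rw [Finset.sum_congr rfl fun (i : Fin n) _ => sum_ite_comp (π ^ (i : ℕ)) (hpow i) f]
  rw [Finset.sum_const, Finset.card_univ, Fintype.card_fin, nsmul_eq_mul]
  have : (n : ℚ) ≠ 0 := by positivity
  field_simp

end Sums

/-- A combinatorial map drawing a graph of minimum degree at least 4 without 4-cycles. -/
structure SparseMap (D V : Type*) where
  rot : Equiv.Perm D
  rev : Equiv.Perm D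
  src : D → V
  rev_rev : ∀ d, rev (rev d) = d
  src_rot : ∀ d, src (rot d) = src d
  src_rev_ne : ∀ d, src (rev d) ≠ src d
  dart_ext : ∀ d e, src d = src e → src (rev d) = src (rev e) → d = e
  four_cycle : ∀ a b c d, src (rev a) = src b → src (rev b) = src c → src (rev c) = src d →
    src (rev d) = src a → src a = src c ∨ src b = src d
  four_le : ∀ d, 4 ≤ Function.minimalPeriod rot d

namespace SparseMap

open Function Equiv

variable {D V : Type*} (M : SparseMap D V)

/-- The face permutation. -/
def face : Perm D := M.rot * M.rev

/-- The face of the dart `d` is a triangle. -/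
def Tri (d : D) : Prop := M.face (M.face (M.face d)) = d

/-- The face of the dart `d` is a pentagon. -/
def Pent (d : D) : Prop := M.face (M.face (M.face (M.face (M.face d)))) = d

/-- The initial vertex of the dart `d` has degree at least 5. -/
def Big (d : D) : Prop := 5 ≤ minimalPeriod M.rot d

lemma face_apply (d : D) : M.face d = M.rot (M.rev d) := rfl

lemma face_rev (d : D) : M.face (M.rev d) = M.rot d := by rw [face_apply, M.rev_rev]

lemma src_face (d : D) : M.src (M.face d) = M.src (M.rev d) := M.src_rot _

lemma tri_face {d : D} : M.Tri (M.face d) ↔ M.Tri d :=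
  M.face.injective.eq_iff

lemma pent_face {d : D} : M.Pent (M.face d) ↔ M.Pent d :=
  M.face.injective.eq_iff

lemma tri_rev {d : D} : M.Tri (M.rev d) ↔ M.Tri (M.rot d) := by
  rw [← tri_face, face_rev]

variable [Finite D]

lemma minimalPeriod_rot (d : D) : minimalPeriod M.rot (M.rot d) = minimalPeriod M.rot d :=
  (minimalPeriod_eq_of_sameCycle (cycles_apply M.rot d)).symm

lemma big_rot {d : D} : M.Big (M.rot d) ↔ M.Big d := by
  rw [Big, Big, minimalPeriod_rot]

lemma big_face {d : D} : M.Big (M.face d) ↔ M.Big (M.rev d) := M.big_rot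

omit [Finite D] in
lemma rot_ne (d : D) : M.rot d ≠ d := by
  intro h
  have := M.four_le d
  have h1 : minimalPeriod M.rot d = 1 := minimalPeriod_eq_one_iff_isFixedPt.2 h
  omega

omit [Finite D] in
lemma rot_rot_ne (d : D) : M.rot (M.rot d) ≠ d := by
  intro h
  have := M.four_le d
  have h1 : minimalPeriod M.rot d ≤ 2 := IsPeriodicPt.minimalPeriod_le (by norm_num) h
  omega

omit [Finite D] in
lemma rot_pow_four {d : D} (h : ¬ M.Big d) : M.rot (M.rot (M.rot (M.rot d))) = d := by
  have := M.four_le d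
  have h1 : minimalPeriod M.rot d = 4 := by unfold Big at h; omega
  have := iterate_minimalPeriod (f := M.rot) (x := d)
  rwa [h1] at this

omit [Finite D] in
lemma face_ne_rev (d : D) : M.face d ≠ M.rev d := M.rot_ne _

omit [Finite D] in
lemma face_ne (d : D) : M.face d ≠ d := fun h =>
  M.src_rev_ne d (by rw [← src_face, h])

omit [Finite D] in
/-- Face boundaries do not turn back. -/
lemma src_face_face_ne (d : D) : M.src (M.face (M.face d)) ≠ M.src d := by
  intro h
  refine M.face_ne_rev d (M.dart_ext _ _ (M.src_face d) ?_)
  rw [← src_face, h, M.rev_rev]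

omit [Finite D] in
lemma face_face_ne (d : D) : M.face (M.face d) ≠ d := fun h =>
  M.src_face_face_ne d (by rw [h])

omit [Finite D] in
lemma face_pow_four_ne (d : D) : M.face (M.face (M.face (M.face d))) ≠ d := by
  intro h
  rcases M.four_cycle d (M.face d) (M.face (M.face d)) (M.face (M.face (M.face d)))
    (M.src_face _).symm (M.src_face _).symm (M.src_face _).symm
    ((M.src_face _).symm.trans (by rw [h])) with h1 | h1
  · exact M.src_face_face_ne d h1.symm
  · exact M.src_face_face_ne (M.face d) h1.symm

omit [Finite D] in
lemma not_tri_and_pent {d : D} (h : M.Tri d) : ¬ M.Pent d := by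
  intro h'
  unfold Tri at h
  unfold Pent at h'
  rw [h] at h'
  exact M.face_face_ne d h'

omit [Finite D] in
/-- Triangular faces do not share edges. -/
lemma not_tri_rev {d : D} (h : M.Tri d) : ¬ M.Tri (M.rev d) := by
  intro h'
  unfold Tri at h h'
  have h3 : M.src (M.rev (M.face (M.face d))) = M.src d := by rw [← src_face, h]
  have h4 : M.src (M.rev (M.face (M.face (M.rev d)))) = M.src (M.rev d) := by rw [← src_face, h']
  -- Two triangles on a common edge bound a 4-cycle unless their apexes coincide. Coinciding apexes
  -- force the rotation at the end of `d` to have period at most 2, against the minimum degree.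
  have hs : M.src (M.face (M.face d)) = M.src (M.face (M.face (M.rev d))) := by
    rcases M.four_cycle (M.face d) (M.face (M.face d)) (M.face (M.rev d))
      (M.face (M.face (M.rev d))) (M.src_face _).symm
      (by rw [h3, src_face, M.rev_rev]) (M.src_face _).symm (by rw [h4, src_face]) with k | k
    · rw [src_face, src_face, M.rev_rev] at k
      exact absurd k (M.src_rev_ne d)
    · exact k
  have e : M.face d = M.rev (M.face (M.face (M.rev d))) := by
    refine M.dart_ext _ _ (by rw [h4, src_face]) ?_
    rw [M.rev_rev, ← hs, src_face]
  have e2 : M.rot (M.face d) = M.rev d := by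
    rw [e, ← face_apply, h']
  exact M.rot_rot_ne (M.rev d) e2

omit [Finite D] in
lemma not_tri_rot {d : D} (h : M.Tri d) : ¬ M.Tri (M.rot d) := by
  rw [← tri_rev]
  exact M.not_tri_rev h

omit [Finite D] in
lemma minimalPeriod_face_of_tri {d : D} (h : M.Tri d) : minimalPeriod M.face d = 3 := by
  have : Fact (Nat.Prime 3) := ⟨by norm_num⟩
  exact minimalPeriod_eq_prime h (M.face_ne d)

omit [Finite D] in
lemma minimalPeriod_face_of_pent {d : D} (h : M.Pent d) : minimalPeriod M.face d = 5 := by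
  have : Fact (Nat.Prime 5) := ⟨by norm_num⟩
  exact minimalPeriod_eq_prime h (M.face_ne d)

lemma six_le_minimalPeriod_face {d : D} (h : ¬ M.Tri d) (h' : ¬ M.Pent d) :
    6 ≤ minimalPeriod M.face d := by
  have h0 := minimalPeriod_perm_pos M.face d
  by_contra hlt
  have hit := iterate_minimalPeriod (f := M.face) (x := d)
  have : minimalPeriod M.face d = 1 ∨ minimalPeriod M.face d = 2 ∨ minimalPeriod M.face d = 3 ∨
    minimalPeriod M.face d = 4 ∨ minimalPeriod M.face d = 5 := by omega
  rcases this with k | k | k | k | k <;> rw [k] at hit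
  · exact M.face_ne d hit
  · exact M.face_face_ne d hit
  · exact h hit
  · exact M.face_pow_four_ne d hit
  · exact h' hit

/-! #### Charges -/

open Classical in
/-- Indicator of triangular faces. -/
noncomputable def tri (d : D) : ℚ := if M.Tri d then 1 else 0

open Classical in
/-- Indicator of vertices of degree at least 5. -/
noncomputable def big (d : D) : ℚ := if M.Big d then 1 else 0

/-- The number of triangles that share an edge with the pentagon of `d`. -/
noncomputable def triCount (d : D) : ℚ :=
  ∑ i : Fin 5, M.tri (M.rev ((M.face ^ (i : ℕ)) d))

/-- The number of vertices of degree at least 5 on the pentagon of `d`. -/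
noncomputable def bigCount (d : D) : ℚ := ∑ i : Fin 5, M.big ((M.face ^ (i : ℕ)) d)

/-- The demand of the pentagon of `d`, in multiples of `1 / 3`. -/
noncomputable def demand (d : D) : ℚ := max (M.triCount d - 3) 0

open Classical in
/-- The charge paid by the initial vertex of `d` to the face of `d`. -/
noncomputable def cornerPay (d : D) : ℚ :=
  if M.Pent d then M.big d * (M.demand d / (3 * M.bigCount d)) else 0

open Classical in
/-- The charge paid across the edge of `d` to the pentagon of `d`, when this pentagon has no
vertex of degree at least 5. -/
noncomputable def edgePay (d : D) : ℚ :=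
  if M.Pent d ∧ M.bigCount d = 0 then M.tri (M.rev d) * (M.demand d / (3 * M.triCount d)) else 0

/-- The charge paid by the initial vertex of `d` through the triangle of `d`. -/
noncomputable def apexPay (d : D) : ℚ := M.edgePay (M.rev (M.face d))

end SparseMap
end StrongChoice

namespace StrongChoice
namespace SparseMap

open Function Equiv

variable {D V : Type*} (M : SparseMap D V)

lemma tri_eq_one {d : D} (h : M.Tri d) : M.tri d = 1 := if_pos h

lemma tri_eq_zero {d : D} (h : ¬ M.Tri d) : M.tri d = 0 := if_neg h

lemma tri_congr {d e : D} (h : M.Tri d ↔ M.Tri e) : M.tri d = M.tri e := by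
  by_cases k : M.Tri d
  · rw [M.tri_eq_one k, M.tri_eq_one (h.1 k)]
  · rw [M.tri_eq_zero k, M.tri_eq_zero (mt h.2 k)]

lemma tri_eq_zero_or (d : D) : M.tri d = 0 ∨ M.tri d = 1 := by
  unfold tri; split_ifs <;> simp

lemma tri_nonneg (d : D) : 0 ≤ M.tri d := by
  rcases M.tri_eq_zero_or d with h | h <;> rw [h]; norm_num

lemma tri_le_one (d : D) : M.tri d ≤ 1 := by
  rcases M.tri_eq_zero_or d with h | h <;> rw [h]; norm_num

lemma big_eq_one {d : D} (h : M.Big d) : M.big d = 1 := if_pos h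

lemma big_eq_zero {d : D} (h : ¬ M.Big d) : M.big d = 0 := if_neg h

lemma big_nonneg (d : D) : 0 ≤ M.big d := by
  unfold big; split_ifs <;> norm_num

lemma triCount_eq (d : D) : M.triCount d = M.tri (M.rev d) + M.tri (M.rev (M.face d)) +
    M.tri (M.rev (M.face (M.face d))) + M.tri (M.rev (M.face (M.face (M.face d)))) +
    M.tri (M.rev (M.face (M.face (M.face (M.face d))))) := by
  rw [triCount, Fin.sum_univ_five]
  rfl

lemma bigCount_eq (d : D) : M.bigCount d = M.big d + M.big (M.face d) +
    M.big (M.face (M.face d)) + M.big (M.face (M.face (M.face d))) +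
    M.big (M.face (M.face (M.face (M.face d)))) := by
  rw [bigCount, Fin.sum_univ_five]
  rfl

lemma triCount_face {d : D} (h : M.Pent d) : M.triCount (M.face d) = M.triCount d := by
  unfold Pent at h
  rw [triCount_eq, triCount_eq, h]
  ring

lemma bigCount_face {d : D} (h : M.Pent d) : M.bigCount (M.face d) = M.bigCount d := by
  unfold Pent at h
  rw [bigCount_eq, bigCount_eq, h]
  ring

lemma demand_face {d : D} (h : M.Pent d) : M.demand (M.face d) = M.demand d := by
  rw [demand, demand, M.triCount_face h]

lemma demand_nonneg (d : D) : 0 ≤ M.demand d := le_max_right _ _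

lemma triCount_nonneg (d : D) : 0 ≤ M.triCount d :=
  Finset.sum_nonneg fun _ _ => M.tri_nonneg _

lemma triCount_le (d : D) : M.triCount d ≤ 5 := by
  rw [triCount_eq]
  linarith [M.tri_le_one (M.rev d), M.tri_le_one (M.rev (M.face d)),
    M.tri_le_one (M.rev (M.face (M.face d))), M.tri_le_one (M.rev (M.face (M.face (M.face d)))),
    M.tri_le_one (M.rev (M.face (M.face (M.face (M.face d)))))]

lemma demand_le_iff {d : D} {c : ℚ} (hc : 0 ≤ c) : M.demand d ≤ c ↔ M.triCount d ≤ 3 + c := by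
  rw [demand, max_le_iff]
  constructor
  · rintro ⟨h, -⟩; linarith
  · intro h; exact ⟨by linarith, hc⟩

lemma demand_le_two (d : D) : M.demand d ≤ 2 :=
  (M.demand_le_iff (by norm_num)).2 (by linarith [M.triCount_le d])

lemma cornerPay_eq_zero {d : D} (h : ¬ M.Pent d) : M.cornerPay d = 0 := if_neg h

lemma cornerPay_eq_zero_of_tri {d : D} (h : M.Tri d) : M.cornerPay d = 0 :=
  M.cornerPay_eq_zero (M.not_tri_and_pent h)

lemma cornerPay_eq_zero_of_not_big {d : D} (h : ¬ M.Big d) : M.cornerPay d = 0 := by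
  unfold cornerPay
  split_ifs
  · rw [M.big_eq_zero h, zero_mul]
  · rfl

lemma big_le_bigCount (d : D) : M.big d ≤ M.bigCount d := by
  rw [bigCount_eq]
  linarith [M.big_nonneg (M.face d), M.big_nonneg (M.face (M.face d)),
    M.big_nonneg (M.face (M.face (M.face d))),
    M.big_nonneg (M.face (M.face (M.face (M.face d))))]

lemma cornerPay_le {d : D} {c k : ℚ} (hd : M.demand d ≤ c) (hk : 0 < k)
    (hb : M.Big d → k ≤ M.bigCount d) : M.cornerPay d ≤ c / (3 * k) := by
  have hc := (M.demand_nonneg d).trans hd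
  unfold cornerPay
  split_ifs
  · by_cases h : M.Big d
    · rw [M.big_eq_one h, one_mul]
      have := hb h
      gcongr
    · rw [M.big_eq_zero h, zero_mul]
      positivity
  · positivity

lemma cornerPay_le_third {d : D} {c : ℚ} (hd : M.demand d ≤ c) : M.cornerPay d ≤ c / 3 := by
  have := M.cornerPay_le hd (k := 1) one_pos fun h => by
    rw [← M.big_eq_one h]; exact M.big_le_bigCount d
  simpa using this

lemma face_four_rot {d : D} (h : M.Pent (M.rot d)) :
    M.face (M.face (M.face (M.face (M.rot d)))) = M.rev d :=
  M.face.injective (by rw [h, face_rev])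

/-- The pentagon of `rot d` shares its two edges at this vertex with the faces of `d` and `rot (rot
d)`. The other three edges meet at most three triangles, which cause no demand. -/
lemma cornerPay_rot_le (d : D) :
    M.cornerPay (M.rot d) ≤ (M.tri d + M.tri (M.rot (M.rot d))) / 3 := by
  have h1 := M.tri_nonneg d
  have h2 := M.tri_nonneg (M.rot (M.rot d))
  by_cases h : M.Pent (M.rot d)
  · refine M.cornerPay_le_third ((M.demand_le_iff (by positivity)).2 ?_)
    have h3 : M.tri (M.rev (M.rot d)) = M.tri (M.rot (M.rot d)) :=
      M.tri_congr M.tri_rev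
    rw [triCount_eq, M.face_four_rot h, M.rev_rev, h3]
    linarith [M.tri_le_one (M.rev (M.face (M.rot d))),
      M.tri_le_one (M.rev (M.face (M.face (M.rot d)))),
      M.tri_le_one (M.rev (M.face (M.face (M.face (M.rot d)))))]
  · rw [M.cornerPay_eq_zero h]
    positivity

lemma edgePay_nonneg (d : D) : 0 ≤ M.edgePay d := by
  unfold edgePay
  split_ifs
  · have := M.tri_nonneg (M.rev d)
    have := M.demand_nonneg d
    have := M.triCount_nonneg d
    positivity
  · exact le_rfl

/-- A pentagon with `t > 3` triangular neighbours asks `(t - 3) / (3 t)` of each; this grows with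
`t` and equals 2/15 at `t = 5`. -/
lemma edgePay_le (d : D) : M.edgePay d ≤ 2 / 15 * M.tri (M.rev d) := by
  have h0 := M.tri_nonneg (M.rev d)
  unfold edgePay
  split_ifs
  · rw [mul_comm]
    refine mul_le_mul_of_nonneg_right ?_ h0
    have h1 := M.triCount_le d
    by_cases h2 : M.triCount d ≤ 3
    · have : M.demand d = 0 := max_eq_right (by linarith)
      rw [this, zero_div]
      norm_num
    · have : M.demand d = M.triCount d - 3 := max_eq_left (by linarith)
      rw [this, div_le_iff₀ (by linarith)]
      linarith
  · positivity

lemma apexPay_nonneg (d : D) : 0 ≤ M.apexPay d := M.edgePay_nonneg _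

lemma apexPay_le (d : D) : M.apexPay d ≤ 2 / 15 * M.tri d := by
  refine (M.edgePay_le _).trans ?_
  rw [M.rev_rev, M.tri_congr M.tri_face]

lemma of_edgePay_pos {d : D} (h : 0 < M.edgePay d) :
    M.Pent d ∧ M.bigCount d = 0 ∧ M.Tri (M.rev d) := by
  unfold edgePay at h
  split_ifs at h with h'
  · refine ⟨h'.1, h'.2, ?_⟩
    by_contra h''
    rw [M.tri_eq_zero h'', zero_mul] at h
    exact lt_irrefl _ h
  · exact absurd h (lt_irrefl _)

lemma not_big_of_bigCount {d : D} (h : M.bigCount d = 0) : ¬ M.Big d := by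
  intro h'
  have := M.big_le_bigCount d
  rw [M.big_eq_one h', h] at this
  norm_num at this

variable [Finite D]

/-- No pentagon with five vertices of degree 4 has a common edge with a triangle whose apex
has degree 4, too. -/
def NoLightConfiguration : Prop :=
  ∀ d, M.Pent d → M.Tri (M.rev d) → M.bigCount d = 0 → M.Big (M.face (M.face (M.rev d)))

variable {M} (hM : M.NoLightConfiguration)

include hM

omit [Finite D] in
lemma big_of_apexPay_pos {d : D} (h : 0 < M.apexPay d) : M.Big d := by
  obtain ⟨h1, h2, h3⟩ := M.of_edgePay_pos h
  have := hM _ h1 h3 h2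
  rw [M.rev_rev] at this h3
  rwa [show M.face (M.face (M.face d)) = d from M.tri_face.1 h3] at this

/-- The end `u` of `d` lies on the pentagon paid by the apex, so it has degree 4, and its faces are
the triangle, that pentagon, the face of `rot d`, and a fourth. If the fourth is a triangle, its
apex is big and lies on the face of `rot d`, so a pentagon there divides its demand among at least
two vertices. If not, that pentagon has a non-triangular neighbour and its demand is at most 1. -/
lemma cornerPay_rot_of_apexPay_pos {d : D} (h : 0 < M.apexPay d) :
    M.cornerPay (M.rot d) ≤ 1 / 3 := by
  have hbig : M.Big (M.rot d) := M.big_rot.2 (big_of_apexPay_pos hM h)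
  obtain ⟨h1, h2, h3⟩ := M.of_edgePay_pos h
  rw [M.rev_rev, M.tri_face] at h3
  set e := M.rev (M.face d) with he
  by_cases hp : M.Pent (M.rot d)
  swap
  · rw [M.cornerPay_eq_zero hp]; norm_num
  have hfe : M.face e = M.rot (M.rot (M.rev d)) := by
    rw [he, M.face_rev, M.face_apply]
  have hfe0 : M.bigCount (M.face e) = 0 := by rw [M.bigCount_face h1, h2]
  have hlight : ¬ M.Big (M.rev d) := by
    have := M.not_big_of_bigCount hfe0
    rwa [hfe, M.big_rot, M.big_rot] at this
  have hq4 := M.rot_pow_four hlight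
  rw [← hfe] at hq4
  have hq : M.face (M.rev (M.rot (M.face e))) = M.rev d := by rw [M.face_rev, hq4]
  have hq3 : M.face (M.face (M.face (M.rot d))) = M.rev (M.rot (M.face e)) := by
    apply M.face.injective
    rw [hq, M.face_four_rot hp]
  by_cases ht : M.Tri (M.rev (M.face e))
  · have h5 := hM _ (M.pent_face.2 h1) ht hfe0
    rw [M.face_rev, M.big_face] at h5
    have h6 : 2 ≤ M.bigCount (M.rot d) := by
      rw [M.bigCount_eq, hq3, M.big_eq_one hbig, M.big_eq_one h5]
      linarith [M.big_nonneg (M.face (M.rot d)), M.big_nonneg (M.face (M.face (M.rot d))),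
        M.big_nonneg (M.face (M.rev (M.rot (M.face e))))]
    have := M.cornerPay_le (M.demand_le_two (M.rot d)) (k := 2) two_pos fun _ => h6
    norm_num at this ⊢
    exact this
  · rw [M.tri_rev] at ht
    refine M.cornerPay_le_third ((M.demand_le_iff (by norm_num)).2 ?_)
    rw [triCount_eq, hq3, M.rev_rev, M.tri_eq_zero ht]
    linarith [M.tri_le_one (M.rev (M.rot d)), M.tri_le_one (M.rev (M.face (M.rot d))),
      M.tri_le_one (M.rev (M.face (M.face (M.rot d)))),
      M.tri_le_one (M.rev (M.face (M.rev (M.rot (M.face e)))))]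

/-- Mirror image of `cornerPay_rot_of_apexPay_pos`: the pentagon now precedes the triangle in the
rotation. -/
lemma cornerPay_of_apexPay_rot_pos {d : D} (h : 0 < M.apexPay (M.rot d)) :
    M.cornerPay d ≤ 1 / 3 := by
  have hbig : M.Big d := M.big_rot.1 (big_of_apexPay_pos hM h)
  obtain ⟨h1, h2, h3⟩ := M.of_edgePay_pos h
  rw [M.rev_rev, M.tri_face] at h3
  set e := M.rev (M.face (M.rot d)) with he
  by_cases hp : M.Pent d
  swap
  · rw [M.cornerPay_eq_zero hp]; norm_num
  have hlight : ¬ M.Big e := M.not_big_of_bigCount h2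
  have hx : M.rot e = M.face (M.face (M.rot d)) := by rw [he, ← M.face_apply]
  have hxd : M.rev (M.rot e) = d := by
    apply M.rot.injective
    rw [← M.face_apply, hx]
    exact h3
  have hy : M.face d = M.rot (M.rot e) := by
    rw [← hxd, M.face_rev]
  have hz4 := M.rot_pow_four hlight
  rw [← hy] at hz4
  have hz : M.face (M.rev (M.rot (M.face d))) = e := by rw [M.face_rev, hz4]
  by_cases ht : M.Tri (M.rot (M.face d))
  · have hb0 : M.bigCount (M.rev (M.rot (M.face d))) = 0 := by
      rw [← M.bigCount_face, hz, h2]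
      rw [← M.pent_face, hz]
      exact h1
    have h5 := hM (M.rev (M.rot (M.face d))) (M.pent_face.1 (by rw [hz]; exact h1))
      (by rw [M.rev_rev]; exact ht) hb0
    rw [M.rev_rev] at h5
    have h6 : M.face (M.face (M.rot (M.face d))) = M.rev (M.face d) := by
      apply M.face.injective
      rw [M.face_rev]
      exact ht
    rw [h6, ← M.big_face] at h5
    have h7 : 2 ≤ M.bigCount d := by
      rw [M.bigCount_eq, M.big_eq_one hbig, M.big_eq_one h5]
      linarith [M.big_nonneg (M.face d), M.big_nonneg (M.face (M.face (M.face d))),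
        M.big_nonneg (M.face (M.face (M.face (M.face d))))]
    have := M.cornerPay_le (M.demand_le_two d) (k := 2) two_pos fun _ => h7
    norm_num at this ⊢
    exact this
  · rw [← M.tri_rev] at ht
    refine M.cornerPay_le_third ((M.demand_le_iff (by norm_num)).2 ?_)
    rw [triCount_eq, M.tri_eq_zero ht]
    linarith [M.tri_le_one (M.rev d),
      M.tri_le_one (M.rev (M.face (M.face d))), M.tri_le_one (M.rev (M.face (M.face (M.face d)))),
      M.tri_le_one (M.rev (M.face (M.face (M.face (M.face d)))))]

omit hM [Finite D] in
lemma cornerPay_le_two_thirds (d : D) : M.cornerPay d ≤ 2 / 3 :=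
  M.cornerPay_le_third (M.demand_le_two d)

/-- Either nothing is paid through the triangle, or at most 2/15 is and the neighbouring corner pays
at most 1/3. The factor `5 / 2` makes both cases one linear inequality: `1/3 + 5/2 * 2/15 = 2/3`. -/
lemma cornerPay_rot_add_apexPay (d : D) :
    M.cornerPay (M.rot d) + 5 / 2 * M.apexPay d ≤ 2 / 3 := by
  rcases (M.apexPay_nonneg d).eq_or_lt with h | h
  · rw [← h]
    linarith [cornerPay_le_two_thirds (M := M) (M.rot d)]
  · linarith [cornerPay_rot_of_apexPay_pos hM h, M.apexPay_le d, M.tri_le_one d]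

lemma cornerPay_add_apexPay_rot (d : D) :
    M.cornerPay d + 5 / 2 * M.apexPay (M.rot d) ≤ 2 / 3 := by
  rcases (M.apexPay_nonneg (M.rot d)).eq_or_lt with h | h
  · rw [← h]
    linarith [cornerPay_le_two_thirds (M := M) d]
  · linarith [cornerPay_of_apexPay_rot_pos hM h, M.apexPay_le (M.rot d), M.tri_le_one (M.rot d)]

-- The two faces share the edge of `d` and are not triangles, so each has demand at most 1. If the
-- other end of this edge is big, both demands are shared and at most 1/6 is paid twice. If it has
-- degree 4, the other two faces there share an edge and are not both triangles, so one of the two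
-- demands vanishes.
omit hM in
lemma cornerPay_add_cornerPay_rot_le_third {d : D} (h : ¬ M.Tri d) (h' : ¬ M.Tri (M.rot d)) :
    M.cornerPay d + M.cornerPay (M.rot d) ≤ 1 / 3 := by
  by_cases hbig : M.Big d
  swap
  · rw [M.cornerPay_eq_zero_of_not_big hbig,
      M.cornerPay_eq_zero_of_not_big (mt M.big_rot.1 hbig)]
    norm_num
  have hbig' : M.Big (M.rot d) := M.big_rot.2 hbig
  have hr : ¬ M.Tri (M.rev d) := by rwa [M.tri_rev]
  have e1 : M.demand d ≤ 1 := by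
    rw [M.demand_le_iff (by norm_num), triCount_eq, M.tri_eq_zero hr]
    linarith [M.tri_le_one (M.rev (M.face d)), M.tri_le_one (M.rev (M.face (M.face d))),
      M.tri_le_one (M.rev (M.face (M.face (M.face d)))),
      M.tri_le_one (M.rev (M.face (M.face (M.face (M.face d)))))]
  have p1 := M.cornerPay_le_third e1
  by_cases hp : M.Pent (M.rot d)
  swap
  · rw [M.cornerPay_eq_zero hp]; linarith
  have h4 := M.face_four_rot hp
  have e2 : M.demand (M.rot d) ≤ 1 := by
    rw [M.demand_le_iff (by norm_num), triCount_eq, h4, M.rev_rev, M.tri_eq_zero h]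
    linarith [M.tri_le_one (M.rev (M.rot d)), M.tri_le_one (M.rev (M.face (M.rot d))),
      M.tri_le_one (M.rev (M.face (M.face (M.rot d)))),
      M.tri_le_one (M.rev (M.face (M.face (M.face (M.rot d)))))]
  have p2 := M.cornerPay_le_third e2
  by_cases hz : M.Big (M.rev d)
  · have b1 : 2 ≤ M.bigCount d := by
      rw [M.bigCount_eq, M.big_eq_one hbig, M.big_eq_one (M.big_face.2 hz)]
      linarith [M.big_nonneg (M.face (M.face d)), M.big_nonneg (M.face (M.face (M.face d))),
        M.big_nonneg (M.face (M.face (M.face (M.face d))))]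
    have b2 : 2 ≤ M.bigCount (M.rot d) := by
      rw [M.bigCount_eq, h4, M.big_eq_one hbig', M.big_eq_one hz]
      linarith [M.big_nonneg (M.face (M.rot d)), M.big_nonneg (M.face (M.face (M.rot d))),
        M.big_nonneg (M.face (M.face (M.face (M.rot d))))]
    have q1 := M.cornerPay_le e1 (k := 2) two_pos fun _ => b1
    have q2 := M.cornerPay_le e2 (k := 2) two_pos fun _ => b2
    linarith
  · have hz4 := M.rot_pow_four hz
    by_cases ht : M.Tri (M.rev (M.face d))
    · have ht2 : ¬ M.Tri (M.rev (M.face (M.face (M.face (M.rot d))))) := by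
        intro ht3
        have hy : M.rev (M.face (M.face (M.face (M.rot d)))) =
            M.rot (M.rot (M.rot (M.rev d))) := by
          apply M.rot.injective
          rw [← M.face_apply, h4, hz4]
        rw [hy] at ht3
        rw [M.tri_rev, M.face_apply] at ht
        exact M.not_tri_rot ht ht3
      have e3 : M.demand (M.rot d) ≤ 0 := by
        rw [M.demand_le_iff le_rfl, triCount_eq, h4, M.rev_rev, M.tri_eq_zero h,
          M.tri_eq_zero ht2]
        linarith [M.tri_le_one (M.rev (M.rot d)), M.tri_le_one (M.rev (M.face (M.rot d))),
          M.tri_le_one (M.rev (M.face (M.face (M.rot d))))]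
      have p3 := M.cornerPay_le_third e3
      linarith
    · have e3 : M.demand d ≤ 0 := by
        rw [M.demand_le_iff le_rfl, triCount_eq, M.tri_eq_zero hr, M.tri_eq_zero ht]
        linarith [M.tri_le_one (M.rev (M.face (M.face d))),
          M.tri_le_one (M.rev (M.face (M.face (M.face d)))),
          M.tri_le_one (M.rev (M.face (M.face (M.face (M.face d)))))]
      have p3 := M.cornerPay_le_third e3
      linarith

omit hM [Finite D] in
lemma cornerPay_le_of_tri (d : D) : M.cornerPay d ≤ 2 / 3 * (1 - M.tri d) := by
  by_cases h : M.Tri d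
  · rw [M.cornerPay_eq_zero_of_tri h, M.tri_eq_one h]; norm_num
  · rw [M.tri_eq_zero h]
    linarith [cornerPay_le_two_thirds (M := M) d]

omit hM [Finite D] in
lemma tri_add_tri_rot (d : D) : M.tri d + M.tri (M.rot d) ≤ 1 := by
  by_cases h : M.Tri d
  · rw [M.tri_eq_zero (M.not_tri_rot h)]
    linarith [M.tri_le_one d]
  · rw [M.tri_eq_zero h]
    linarith [M.tri_le_one (M.rot d)]

omit hM in
lemma cornerPay_add_cornerPay_rot (d : D) :
    M.cornerPay d + M.cornerPay (M.rot d) ≤ (1 + M.tri d + M.tri (M.rot d)) / 3 := by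
  have h1 := cornerPay_le_of_tri (M := M) d
  have h2 := cornerPay_le_of_tri (M := M) (M.rot d)
  by_cases h : M.Tri d
  · rw [M.tri_eq_one h, M.tri_eq_zero (M.not_tri_rot h)] at *
    linarith
  by_cases h' : M.Tri (M.rot d)
  · rw [M.tri_eq_one h', M.tri_eq_zero h] at *
    linarith
  · rw [M.tri_eq_zero h, M.tri_eq_zero h']
    linarith [cornerPay_add_cornerPay_rot_le_third h h']

end SparseMap
end StrongChoice

/-! ### The balance of charges -/

namespace StrongChoice
namespace SparseMap

open Function Equiv

variable {D V : Type*} {M : SparseMap D V}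

section Vertex

variable [Finite D]

omit [Finite D] in
lemma rot_pow_add_one {n : ℕ} [NeZero n] {d : D} (h : minimalPeriod M.rot d = n) (i : Fin n) :
    (M.rot ^ ((i + 1 : Fin n) : ℕ)) d = M.rot ((M.rot ^ (i : ℕ)) d) := by
  rw [← Perm.mul_apply, ← pow_succ']
  have key : ∀ k : ℕ, (M.rot ^ k) d = M.rot^[k] d := fun k => by
    rw [Perm.iterate_eq_pow]
  rw [key, key, Fin.val_add, ← iterate_mod_minimalPeriod_eq (n := (i : ℕ) + 1), h]
  congr 1
  rw [Fin.val_one', Nat.add_mod_mod]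

variable (hM : M.NoLightConfiguration)

include hM

lemma sum_pay_le_of_five {d : D} (h : minimalPeriod M.rot d = 5) :
    ∑ i : Fin 5, (M.cornerPay ((M.rot ^ (i : ℕ)) d) + M.apexPay ((M.rot ^ (i : ℕ)) d)) ≤ 1 := by
  refine sum_charge_five (fun i => M.tri ((M.rot ^ (i : ℕ)) d))
    (fun i => M.cornerPay ((M.rot ^ (i : ℕ)) d)) (fun i => M.apexPay ((M.rot ^ (i : ℕ)) d))
    (fun i => M.tri_eq_zero_or _) (fun i => ?_) (fun i => ?_) (fun i => cornerPay_le_of_tri _)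
    (fun i => ?_) (fun i => M.apexPay_le _) (fun i => ?_) (fun i => ?_)
  · rw [rot_pow_add_one h]; exact tri_add_tri_rot _
  · rw [show i + 2 = i + 1 + 1 by rw [add_assoc]; rfl]
    simp only [rot_pow_add_one h]; exact M.cornerPay_rot_le _
  · rw [rot_pow_add_one h]; exact cornerPay_add_cornerPay_rot _
  · rw [rot_pow_add_one h]; exact cornerPay_rot_add_apexPay hM _
  · rw [rot_pow_add_one h]; exact cornerPay_add_apexPay_rot hM _

lemma sum_pay_le_of_six {d : D} (h : minimalPeriod M.rot d = 6) :
    ∑ i : Fin 6, (M.cornerPay ((M.rot ^ (i : ℕ)) d) + M.apexPay ((M.rot ^ (i : ℕ)) d)) ≤ 2 := by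
  refine sum_charge_six (fun i => M.tri ((M.rot ^ (i : ℕ)) d))
    (fun i => M.cornerPay ((M.rot ^ (i : ℕ)) d)) (fun i => M.apexPay ((M.rot ^ (i : ℕ)) d))
    (fun i => M.tri_eq_zero_or _) (fun i => ?_) (fun i => ?_) (fun i => cornerPay_le_of_tri _)
    (fun i => M.apexPay_le _) (fun i => ?_) (fun i => ?_)
  · rw [rot_pow_add_one h]; exact tri_add_tri_rot _
  · rw [show i + 2 = i + 1 + 1 by rw [add_assoc]; rfl]
    simp only [rot_pow_add_one h]; exact M.cornerPay_rot_le _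
  · rw [rot_pow_add_one h]; exact cornerPay_rot_add_apexPay hM _
  · rw [rot_pow_add_one h]; exact cornerPay_add_apexPay_rot hM _

end Vertex

variable [Fintype D]

/-- Here a crude bound will do: each triangular corner accounts for at most `2/3 + 2/15 = 4/5`, and
at most half of the corners are triangles, whence 2/5 per corner. This is below the available `1 -
4/7 = 3/7`. -/
lemma sum_pay_le_of_seven_le :
    ∑ d, (if 7 ≤ minimalPeriod M.rot d then M.cornerPay d + M.apexPay d else 0) ≤
      ∑ d, (if 7 ≤ minimalPeriod M.rot d then 2 / 5 else 0) := by
  have hq : ∀ d, 7 ≤ minimalPeriod M.rot (M.rot d) ↔ 7 ≤ minimalPeriod M.rot d := fun d => by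
    rw [M.minimalPeriod_rot]
  have s1 := sum_ite_comp M.rot (q := fun d => 7 ≤ minimalPeriod M.rot d) hq M.cornerPay
  have s2 := sum_ite_comp M.rot (q := fun d => 7 ≤ minimalPeriod M.rot d) hq M.tri
  have s3 := sum_ite_comp M.rot (q := fun d => 7 ≤ minimalPeriod M.rot d) hq fun d => M.tri (M.rot d)
  have hpay : ∑ d, (if 7 ≤ minimalPeriod M.rot d then M.cornerPay (M.rot d) else 0) ≤
      ∑ d, ((if 7 ≤ minimalPeriod M.rot d then M.tri d else 0) / 3 +
        (if 7 ≤ minimalPeriod M.rot d then M.tri (M.rot (M.rot d)) else 0) / 3) := by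
    refine Finset.sum_le_sum fun d _ => ?_
    split_ifs
    · linarith [M.cornerPay_rot_le d]
    · norm_num
  have hapex : ∑ d, (if 7 ≤ minimalPeriod M.rot d then M.apexPay d else 0) ≤
      ∑ d, 2 / 15 * (if 7 ≤ minimalPeriod M.rot d then M.tri d else 0) := by
    refine Finset.sum_le_sum fun d _ => ?_
    split_ifs
    · exact M.apexPay_le d
    · norm_num
  have htri : ∑ d, ((if 7 ≤ minimalPeriod M.rot d then M.tri d else 0) +
      (if 7 ≤ minimalPeriod M.rot d then M.tri (M.rot d) else 0)) ≤
      ∑ d, 5 / 2 * (if 7 ≤ minimalPeriod M.rot d then (2 / 5 : ℚ) else 0) := by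
    refine Finset.sum_le_sum fun d _ => ?_
    split_ifs
    · linarith [tri_add_tri_rot (M := M) d]
    · norm_num
  have hsplit : ∑ d, (if 7 ≤ minimalPeriod M.rot d then M.cornerPay d + M.apexPay d else 0) =
      ∑ d, (if 7 ≤ minimalPeriod M.rot d then M.cornerPay d else 0) +
      ∑ d, (if 7 ≤ minimalPeriod M.rot d then M.apexPay d else 0) := by
    rw [← Finset.sum_add_distrib]
    exact Finset.sum_congr rfl fun d _ => by split_ifs <;> simp
  rw [Finset.sum_add_distrib, ← Finset.sum_div, ← Finset.sum_div] at hpay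
  rw [← Finset.mul_sum] at hapex
  rw [Finset.sum_add_distrib, ← Finset.mul_sum] at htri
  rw [hsplit]
  linarith

lemma sum_pay_le_of_eq {n : ℕ} (hn : 0 < n) {c : ℚ}
    (h : ∀ d, minimalPeriod M.rot d = n →
      ∑ i : Fin n, (M.cornerPay ((M.rot ^ (i : ℕ)) d) + M.apexPay ((M.rot ^ (i : ℕ)) d)) ≤ c) :
    ∑ d, (if minimalPeriod M.rot d = n then M.cornerPay d + M.apexPay d else 0) ≤
      ∑ d, (if minimalPeriod M.rot d = n then c / n else 0) := by
  have hq : ∀ d, minimalPeriod M.rot (M.rot d) = n ↔ minimalPeriod M.rot d = n := fun d => by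
    rw [M.minimalPeriod_rot]
  rw [sum_ite_average M.rot hq _ n hn]
  refine Finset.sum_le_sum fun d _ => ?_
  split_ifs with hd
  · have := h d hd
    gcongr
  · exact le_rfl

/-- The vertices can afford what they pay. -/
lemma sum_pay_le (hM : M.NoLightConfiguration) :
    ∑ d, (M.cornerPay d + M.apexPay d) ≤ ∑ d, (1 - 4 / (minimalPeriod M.rot d : ℚ)) := by
  classical
  have h5 := sum_pay_le_of_eq (M := M) (n := 5) (by norm_num) fun d hd => sum_pay_le_of_five hM hd
  have h6 := sum_pay_le_of_eq (M := M) (n := 6) (by norm_num) fun d hd => sum_pay_le_of_six hM hd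
  have h7 := sum_pay_le_of_seven_le (M := M)
  have e1 : ∀ d, M.cornerPay d + M.apexPay d ≤
      (if minimalPeriod M.rot d = 5 then M.cornerPay d + M.apexPay d else 0) +
      (if minimalPeriod M.rot d = 6 then M.cornerPay d + M.apexPay d else 0) +
      (if 7 ≤ minimalPeriod M.rot d then M.cornerPay d + M.apexPay d else 0) := by
    intro d
    have h4 := M.four_le d
    by_cases hb : M.Big d
    · unfold Big at hb
      have : minimalPeriod M.rot d = 5 ∨ minimalPeriod M.rot d = 6 ∨ 7 ≤ minimalPeriod M.rot d := by
        omega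
      rcases this with h | h | h
      · simp [h]
      · simp [h]
      · rw [if_neg (by omega), if_neg (by omega), if_pos h]; linarith
    · have h1 := M.cornerPay_eq_zero_of_not_big hb
      have h2 : M.apexPay d ≤ 0 := not_lt.1 (mt (big_of_apexPay_pos hM) hb)
      unfold Big at hb
      rw [if_neg (by omega), if_neg (by omega), if_neg (by omega), h1]
      linarith
  have e2 : ∀ d, (if minimalPeriod M.rot d = 5 then (1 : ℚ) / (5 : ℕ) else 0) +
      (if minimalPeriod M.rot d = 6 then (2 : ℚ) / (6 : ℕ) else 0) +
      (if 7 ≤ minimalPeriod M.rot d then (2 : ℚ) / 5 else 0) ≤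
      1 - 4 / (minimalPeriod M.rot d : ℚ) := by
    intro d
    have h4 := M.four_le d
    have : minimalPeriod M.rot d = 4 ∨ minimalPeriod M.rot d = 5 ∨ minimalPeriod M.rot d = 6 ∨
        7 ≤ minimalPeriod M.rot d := by omega
    rcases this with h | h | h | h
    · simp [h]
    · simp [h]; norm_num
    · simp [h]; norm_num
    · rw [if_neg (by omega), if_neg (by omega), if_pos h]
      have h' : (7 : ℚ) ≤ minimalPeriod M.rot d := by exact_mod_cast h
      have : 4 / (minimalPeriod M.rot d : ℚ) ≤ 3 / 5 := by
        rw [div_le_iff₀ (by linarith)]; linarith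
      linarith
  have s1 := Finset.sum_le_sum fun d (_ : d ∈ Finset.univ) => e1 d
  have s2 := Finset.sum_le_sum fun d (_ : d ∈ Finset.univ) => e2 d
  simp only [Finset.sum_add_distrib] at s1 s2 ⊢
  linarith

-- Around a pentagon the payments add up to a third of its demand: equal shares of its big vertices
-- if there are any, otherwise equal shares over its triangular edges. A positive demand guarantees
-- such edges. `apexPay` only reindexes `edgePay`.
open Classical in
lemma sum_demand_eq_sum_pay :
    ∑ d, (if M.Pent d then M.demand d / 15 else 0) = ∑ d, (M.cornerPay d + M.apexPay d) := by
  have hq : ∀ d, M.Pent (M.face d) ↔ M.Pent d := fun d => M.pent_face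
  have hpow : ∀ (k : ℕ) d, M.Pent d → M.Pent ((M.face ^ k) d) ∧
      M.demand ((M.face ^ k) d) = M.demand d ∧ M.bigCount ((M.face ^ k) d) = M.bigCount d ∧
      M.triCount ((M.face ^ k) d) = M.triCount d := by
    intro k
    induction k with
    | zero => intro d h; exact ⟨h, rfl, rfl, rfl⟩
    | succ k ih =>
      intro d h
      obtain ⟨h1, h2, h3, h4⟩ := ih d h
      rw [pow_succ', Perm.mul_apply, M.pent_face, M.demand_face h1, M.bigCount_face h1,
        M.triCount_face h1]
      exact ⟨h1, h2, h3, h4⟩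
  have hapex : ∑ d, M.apexPay d = ∑ d, M.edgePay d :=
    Equiv.sum_comp (M.face.trans ⟨M.rev, M.rev, M.rev_rev, M.rev_rev⟩) M.edgePay
  have hedge : ∑ d, M.edgePay d = ∑ d, (if M.Pent d then
      (if M.bigCount d = 0 then M.tri (M.rev d) * (M.demand d / (3 * M.triCount d)) else 0)
      else 0) := by
    refine Finset.sum_congr rfl fun d _ => ?_
    unfold edgePay
    by_cases h : M.Pent d <;> simp [h]
  have hcorner : ∑ d, M.cornerPay d = ∑ d, (if M.Pent d then
      M.big d * (M.demand d / (3 * M.bigCount d)) else 0) := rfl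
  have a1 := sum_ite_average M.face hq
    (fun d => M.big d * (M.demand d / (3 * M.bigCount d))) 5 (by norm_num)
  have a2 := sum_ite_average M.face hq (fun d => if M.bigCount d = 0 then
    M.tri (M.rev d) * (M.demand d / (3 * M.triCount d)) else 0) 5 (by norm_num)
  rw [Finset.sum_add_distrib, hapex, hedge, hcorner, a1, a2, ← Finset.sum_add_distrib]
  refine Finset.sum_congr rfl fun d _ => ?_
  split_ifs with h
  swap
  · norm_num
  have h1 : ∀ i : Fin 5, M.demand ((M.face ^ (i : ℕ)) d) = M.demand d := fun i => (hpow i d h).2.1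
  have h2 : ∀ i : Fin 5, M.bigCount ((M.face ^ (i : ℕ)) d) = M.bigCount d :=
    fun i => (hpow i d h).2.2.1
  have h3 : ∀ i : Fin 5, M.triCount ((M.face ^ (i : ℕ)) d) = M.triCount d :=
    fun i => (hpow i d h).2.2.2
  simp only [h1, h2, h3]
  rw [← Finset.sum_mul]
  change _ = M.bigCount d * _ / _ + _
  by_cases hb : M.bigCount d = 0
  · simp only [hb, if_true, zero_mul, zero_div, zero_add]
    rw [← Finset.sum_mul]
    change _ = M.triCount d * _ / _
    rcases (M.demand_nonneg d).eq_or_lt with hd | hd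
    · simp only [← hd, zero_div, mul_zero]
    · have : M.triCount d ≠ 0 := by
        intro ht
        rw [demand, ht] at hd
        norm_num at hd
      field_simp
      norm_num
  · simp only [hb, if_false, Finset.sum_const_zero]
    field_simp
    ring

/-- The faces need no more charge than they receive. -/
lemma neg_sum_face_le :
    -∑ d, (1 - 4 / (minimalPeriod M.face d : ℚ)) ≤ ∑ d, (M.cornerPay d + M.apexPay d) := by
  classical
  rw [← sum_demand_eq_sum_pay]
  have hq : ∀ d, M.Pent (M.face d) ↔ M.Pent d := fun d => M.pent_face
  have hrev : ∑ d, M.tri (M.rev d) = ∑ d, M.tri d :=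
    Equiv.sum_comp (⟨M.rev, M.rev, M.rev_rev, M.rev_rev⟩ : Perm D) M.tri
  -- The right side is the face charge per dart after each triangle has taken 1/3 across each edge.
  -- It vanishes on triangles, and on faces of length at least 6 it is not negative because `1 - 4/6
  -- = 1/3`.
  have e1 : ∀ d, (if M.Pent d then 1 / 5 - M.tri (M.rev d) / 3 else 0) ≤
      (1 - 4 / (minimalPeriod M.face d : ℚ)) + M.tri d / 3 - M.tri (M.rev d) / 3 := by
    intro d
    have h0 := M.tri_le_one (M.rev d)
    by_cases ht : M.Tri d
    · rw [M.minimalPeriod_face_of_tri ht, if_neg (M.not_tri_and_pent ht), M.tri_eq_one ht,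
        M.tri_eq_zero (M.not_tri_rev ht)]
      norm_num
    by_cases hp : M.Pent d
    · rw [M.minimalPeriod_face_of_pent hp, if_pos hp, M.tri_eq_zero ht]
      push_cast
      linarith
    · rw [if_neg hp, M.tri_eq_zero ht]
      have h6 : (6 : ℚ) ≤ minimalPeriod M.face d := by
        exact_mod_cast M.six_le_minimalPeriod_face ht hp
      have : 4 / (minimalPeriod M.face d : ℚ) ≤ 2 / 3 := by
        rw [div_le_iff₀ (by linarith)]; linarith
      linarith
  have e2 : ∑ d, (if M.Pent d then 1 / 5 - M.tri (M.rev d) / 3 else 0) =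
      ∑ d, (if M.Pent d then (3 - M.triCount d) / 15 else 0) := by
    rw [sum_ite_average M.face hq _ 5 (by norm_num)]
    refine Finset.sum_congr rfl fun d _ => ?_
    split_ifs
    · have : ∑ i : Fin 5, (1 / 5 - M.tri (M.rev ((M.face ^ (i : ℕ)) d)) / 3) =
          1 - M.triCount d / 3 := by
        rw [Finset.sum_sub_distrib, triCount, Finset.sum_div]
        simp
      rw [this]
      push_cast
      ring
    · rfl
  have e3 : -∑ d, (if M.Pent d then (3 - M.triCount d) / 15 else 0) ≤
      ∑ d, (if M.Pent d then M.demand d / 15 else 0) := by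
    rw [← Finset.sum_neg_distrib]
    refine Finset.sum_le_sum fun d _ => ?_
    split_ifs
    · have : M.triCount d - 3 ≤ M.demand d := le_max_left _ _
      linarith
    · norm_num
  have s1 := Finset.sum_le_sum fun d (_ : d ∈ Finset.univ) => e1 d
  rw [Finset.sum_sub_distrib, Finset.sum_add_distrib, ← Finset.sum_div, ← Finset.sum_div, hrev,
    e2] at s1
  linarith

/-- In a plane map of minimum degree at least 4 without 4-cycles there is a pentagon with five
vertices of degree 4 and a triangle adjacent to it whose apex has degree 4, too. -/
theorem exists_light_configuration (h : 0 < ∑ d, (1 / (minimalPeriod M.rot d : ℚ) +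
    1 / (minimalPeriod M.face d : ℚ) - 1 / 2)) :
    ∃ d, M.Pent d ∧ M.Tri (M.rev d) ∧ M.bigCount d = 0 ∧ ¬ M.Big (M.face (M.face (M.rev d))) := by
  by_contra hcon
  have hM : M.NoLightConfiguration := fun d h1 h2 h3 => by
    by_contra h4
    exact hcon ⟨d, h1, h2, h3, h4⟩
  have h1 := sum_pay_le hM
  have h2 := neg_sum_face_le (M := M)
  -- The total charge is -4 times the Euler characteristic.
  have h3 : ∑ d, (1 / (minimalPeriod M.rot d : ℚ) + 1 / (minimalPeriod M.face d : ℚ) - 1 / 2) =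
      -(∑ d, (1 - 4 / (minimalPeriod M.rot d : ℚ)) +
        ∑ d, (1 - 4 / (minimalPeriod M.face d : ℚ))) / 4 := by
    rw [← Finset.sum_add_distrib, ← Finset.sum_neg_distrib, Finset.sum_div]
    refine Finset.sum_congr rfl fun d _ => ?_
    ring
  rw [h3] at h
  linarith

end SparseMap
end StrongChoice

namespace StrongChoice

/-! ### Euler's formula for planar graphs -/

section Euler

open Equiv Equiv.Perm

variable {V : Type*} {G : SimpleGraph V}

lemma RotationSystem.fst_eq_of_sameCycle (R : RotationSystem G) {d e : G.Dart}
    (h : R.next.SameCycle d e) : d.fst = e.fst :=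
  (cycles_le_iff (t := Setoid.ker fun d : G.Dart => d.fst)).2 (fun a => (R.fst_next a).symm) h

lemma dartReversal_dartReversal (d : G.Dart) : dartReversal G (dartReversal G d) = d :=
  SimpleGraph.Dart.symm_symm d

lemma dartReversal_ne (d : G.Dart) : dartReversal G d ≠ d :=
  SimpleGraph.Dart.symm_ne d

variable [Finite V]

instance finite_dart : Finite G.Dart :=
  Finite.of_injective _ SimpleGraph.Dart.toProd_injective

lemma card_dart : Nat.card G.Dart = 2 * Nat.card G.edgeSet := by
  classical
  have := Fintype.ofFinite V
  rw [Nat.card_eq_fintype_card, Nat.card_eq_fintype_card, G.dart_card_eq_twice_card_edges,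
    ← SimpleGraph.edgeFinset_card]

/-- For vertices, edges and components one inequality each is enough, both for Euler's inequality
and for the excess of a planar rotation. An isolated vertex adds one vertex, one face and one
component, so its contributions cancel. -/
lemma RotationSystem.card_vertices_le (R : RotationSystem G) :
    Nat.card V ≤ numCycles R.next + Nat.card {v : V // ∀ w, ¬ G.Adj v w} := by
  rw [numCycles, numClasses, ← Nat.card_sum]
  refine Nat.card_le_card_of_surjective (Sum.elim (Quotient.lift (fun d : G.Dart => d.fst)
    fun a b h => R.fst_eq_of_sameCycle h) Subtype.val) fun v => ?_
  by_cases h : ∀ w, ¬ G.Adj v w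
  · exact ⟨Sum.inr ⟨v, h⟩, rfl⟩
  · push Not at h
    obtain ⟨w, hw⟩ := h
    exact ⟨Sum.inl (Quotient.mk _ ⟨(v, w), hw⟩), rfl⟩

lemma card_edgeSet_le : Nat.card G.edgeSet ≤ numCycles (dartReversal G) := by
  rw [numCycles, numClasses]
  refine Nat.card_le_card_of_surjective (Quotient.lift
    (fun d : G.Dart => (⟨d.edge, d.edge_mem⟩ : G.edgeSet)) fun a b h => ?_) ?_
  · exact (cycles_le_iff (t := Setoid.ker fun d : G.Dart => (⟨d.edge, d.edge_mem⟩ : G.edgeSet))).2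
      (fun a => Subtype.ext (SimpleGraph.Dart.edge_symm a).symm) h
  · rintro ⟨e, he⟩
    induction e using Sym2.ind with
    | _ u v => exact ⟨Quotient.mk _ ⟨(u, v), he⟩, rfl⟩

lemma RotationSystem.numClasses_add_le (R : RotationSystem G) :
    numClasses (cycles R.next ⊔ cycles (dartReversal G)) +
      Nat.card {v : V // ∀ w, ¬ G.Adj v w} ≤ Nat.card G.ConnectedComponent := by
  set t := cycles R.next ⊔ cycles (dartReversal G) with ht
  have hker : t ≤ Setoid.ker fun d : G.Dart => G.connectedComponentMk d.fst := by
    refine sup_le (cycles_le_iff.2 fun a => ?_) (cycles_le_iff.2 fun a => ?_)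
    · exact congrArg G.connectedComponentMk (R.fst_next a).symm
    · exact SimpleGraph.ConnectedComponent.sound a.adj.reachable
  have hwalk : ∀ {u v : V}, G.Walk u v → ∀ d e : G.Dart, d.fst = u → e.fst = v → t d e := by
    intro u v p
    induction p with
    | nil =>
      intro d e hd he
      exact (le_sup_left : cycles R.next ≤ t) (R.sameCycle d e (hd.trans he.symm))
    | @cons u v w h p ih =>
      intro d e hd he
      have h1 : t d ⟨(u, v), h⟩ := (le_sup_left : cycles R.next ≤ t) (R.sameCycle d _ hd)
      have h2 : t ⟨(u, v), h⟩ (dartReversal G ⟨(u, v), h⟩) :=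
        (le_sup_right : cycles (dartReversal G) ≤ t) (cycles_apply _ _)
      exact t.trans h1 (t.trans h2 (ih _ e rfl he))
  rw [numClasses, ← Nat.card_sum]
  refine Nat.card_le_card_of_injective (Sum.elim (Quotient.lift
    (fun d : G.Dart => G.connectedComponentMk d.fst) fun a b h => hker h)
    fun v => G.connectedComponentMk v.1) ?_
  have hiso : ∀ (v : {v : V // ∀ w, ¬ G.Adj v w}) (w : V), G.Reachable v.1 w → v.1 = w := by
    rintro v w ⟨p⟩
    cases p with
    | nil => rfl
    | cons h p => exact absurd h (v.2 _)
  rintro (a | a) (b | b) hab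
  · induction a using Quotient.inductionOn with
    | h d =>
    induction b using Quotient.inductionOn with
    | h e =>
    obtain ⟨p⟩ := SimpleGraph.ConnectedComponent.exact hab
    exact congrArg Sum.inl (Quotient.sound (hwalk p d e rfl rfl))
  · induction a using Quotient.inductionOn with
    | h d =>
    have := hiso b d.fst (SimpleGraph.ConnectedComponent.exact hab).symm
    exact absurd d.adj (this ▸ b.2 d.snd)
  · induction b using Quotient.inductionOn with
    | h d =>
    have := hiso a d.fst (SimpleGraph.ConnectedComponent.exact hab)
    exact absurd d.adj (this ▸ a.2 d.snd)
  · exact congrArg Sum.inr (Subtype.ext (hiso a b.1 (SimpleGraph.ConnectedComponent.exact hab)))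

lemma RotationSystem.card_face (R : RotationSystem G) : Nat.card R.Face =
    numCycles (R.next * dartReversal G) + Nat.card {v : V // ∀ w, ¬ G.Adj v w} :=
  Nat.card_sum

/-- Euler's inequality for rotation systems. -/
theorem RotationSystem.euler_le (R : RotationSystem G) :
    Nat.card V + Nat.card R.Face ≤ Nat.card G.edgeSet + 2 * Nat.card G.ConnectedComponent := by
  classical
  have h1 := R.card_vertices_le
  have h2 := card_edgeSet_le (G := G)
  have h3 := R.numClasses_add_le
  have h4 := eulerExcess_nonpos (σ := R.next) dartReversal_dartReversal dartReversal_ne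
  have h5 := R.card_face
  have h6 := card_dart (G := G)
  unfold eulerExcess at h4
  omega

lemma RotationSystem.eulerExcess_nonneg (R : RotationSystem G)
    (h : Nat.card V + Nat.card R.Face =
      Nat.card G.edgeSet + 2 * Nat.card G.ConnectedComponent) :
    0 ≤ eulerExcess R.next (dartReversal G) := by
  have h1 := R.card_vertices_le
  have h2 := card_edgeSet_le (G := G)
  have h3 := R.numClasses_add_le
  have h5 := R.card_face
  have h6 := card_dart (G := G)
  unfold eulerExcess
  omega

end Euler

/-! ### 4-cycles as closed sequences of four vertices -/

section FourCycles

variable {V : Type*} {G : SimpleGraph V}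

lemma noCycleOfLength_four_iff : NoCycleOfLength G 4 ↔
    ∀ a b c d, G.Adj a b → G.Adj b c → G.Adj c d → G.Adj d a → a = c ∨ b = d := by
  constructor
  · intro h a b c d hab hbc hcd hda
    by_contra hne
    push Not at hne
    refine h a (.cons hab (.cons hbc (.cons hcd (.cons hda .nil)))) ?_ rfl
    have := hab.ne
    have := hbc.ne
    have := hcd.ne
    have := hda.ne
    simp [SimpleGraph.Walk.isCycle_def, SimpleGraph.Walk.isTrail_def]
    grind
  · rintro h v p hp hlen
    match p, hp, hlen with
    | .cons hab (.cons hbc (.cons hcd (.cons hda .nil))), hp, _ =>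
      have := hp.support_nodup
      simp at this
      rcases h _ _ _ _ hab hbc hcd hda with k | k
      · exact this.2.1.2 k.symm
      · exact this.1.2.1 k

end FourCycles

/-! ### Light configurations in planar graphs -/

section Light

open Function Equiv Equiv.Perm

variable {V : Type*} {G : SimpleGraph V} [DecidableRel G.Adj]

/-- A pentagon `v₁ v₂ v₃ v₄ v₅` and a triangle `v₁ v₂ v₆` in `W`, all of whose vertices have
exactly four neighbours in `W`. -/
structure LightConfiguration (G : SimpleGraph V) [DecidableRel G.Adj] (W : Finset V)
    (v : Fin 6 → V) : Prop where
  mem : ∀ i, v i ∈ W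
  card : ∀ i, (W.filter (G.Adj (v i))).card = 4
  adj01 : G.Adj (v 0) (v 1)
  adj12 : G.Adj (v 1) (v 2)
  adj23 : G.Adj (v 2) (v 3)
  adj34 : G.Adj (v 3) (v 4)
  adj40 : G.Adj (v 4) (v 0)
  adj05 : G.Adj (v 0) (v 5)
  adj15 : G.Adj (v 1) (v 5)
  ne02 : v 0 ≠ v 2
  ne13 : v 1 ≠ v 3
  ne24 : v 2 ≠ v 4
  ne30 : v 3 ≠ v 0
  ne41 : v 4 ≠ v 1

theorem exists_lightConfiguration [Finite V] (hG : Planar G) (h4 : NoCycleOfLength G 4)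
    {W : Finset V} (hne : W.Nonempty) (hW : ∀ v ∈ W, 4 ≤ (W.filter (G.Adj v)).card) :
    ∃ v, LightConfiguration G W v := by
  classical
  have := Fintype.ofFinite V
  rw [noCycleOfLength_four_iff] at h4
  obtain ⟨R, hR⟩ := hG
  obtain ⟨w, hw⟩ := hne
  obtain ⟨w', hw'⟩ : (W.filter (G.Adj w)).Nonempty := by
    rw [← Finset.card_pos]
    have := hW w hw
    omega
  rw [Finset.mem_filter] at hw'
  obtain ⟨σ, α, hα, hσ, hpos⟩ := exists_submap (σ := R.next) dartReversal_dartReversal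
    dartReversal_ne (R.eulerExcess_nonneg hR) (fun d => d.fst ∈ W ∧ d.snd ∈ W)
    (fun d => and_comm) ⟨⟨(w, w'), hw'.2⟩, hw, hw'.1⟩
  -- The restricted rotation keeps all darts from a vertex into `W` in one cycle, so its periods are
  -- the degrees in the subgraph induced on `W`.
  have hper : ∀ d, minimalPeriod σ d = (W.filter (G.Adj d.1.fst)).card := by
    intro d
    rw [← ncard_sameCycle, ← Set.ncard_coe_finset]
    have hset : {e | SameCycle σ d e} =
        {e : {d : G.Dart // d.fst ∈ W ∧ d.snd ∈ W} | e.1.fst = d.1.fst} := by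
      ext e
      simp only [Set.mem_ofPred_eq, hσ]
      exact ⟨fun h => (R.fst_eq_of_sameCycle h).symm, fun h => R.sameCycle _ _ h.symm⟩
    have hinj : Set.InjOn (fun e : {d : G.Dart // d.fst ∈ W ∧ d.snd ∈ W} => e.1.snd)
        {e | e.1.fst = d.1.fst} := fun e he f hf hef =>
      Subtype.ext (SimpleGraph.Dart.ext _ _ (Prod.ext (he.trans hf.symm) hef))
    rw [hset, ← hinj.ncard_image]
    congr 1
    ext v
    simp only [Set.mem_image, Set.mem_ofPred_eq, Finset.coe_filter]
    constructor
    · rintro ⟨e, he, rfl⟩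
      exact ⟨e.2.2, he ▸ e.1.adj⟩
    · rintro ⟨hv, hd⟩
      exact ⟨⟨⟨(d.1.fst, v), hd⟩, d.2.1, hv⟩, rfl, rfl⟩
  have hsnd : ∀ d, (α d).1.fst = d.1.snd := fun d => by rw [hα]; rfl
  let M : SparseMap {d : G.Dart // d.fst ∈ W ∧ d.snd ∈ W} V :=
    { rot := σ
      rev := α
      src := fun d => d.1.fst
      rev_rev := fun d => Subtype.ext (by rw [hα, hα, dartReversal_dartReversal])
      src_rot := fun d => (R.fst_eq_of_sameCycle ((hσ _ _).1 (cycles_apply σ d))).symm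
      src_rev_ne := fun d => by rw [hsnd]; exact d.1.adj.ne'
      dart_ext := fun d e h h' => by
        rw [hsnd, hsnd] at h'
        exact Subtype.ext (SimpleGraph.Dart.ext _ _ (Prod.ext h h'))
      four_cycle := fun a b c d hab hbc hcd hda => by
        rw [hsnd] at hab hbc hcd hda
        exact h4 _ _ _ _ (hab ▸ a.1.adj) (hbc ▸ b.1.adj) (hcd ▸ c.1.adj) (hda ▸ d.1.adj)
      four_le := fun d => by rw [hper]; exact hW _ d.2.1 }
  obtain ⟨d, h1, h2, h3, h5⟩ := M.exists_light_configuration hpos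
  have hsrc : ∀ d, M.src d ∈ W := fun d => d.2.1
  have hadj : ∀ d, G.Adj (M.src d) (M.src (M.face d)) := fun d => by
    rw [M.src_face]
    change G.Adj d.1.fst (α d).1.fst
    rw [hsnd]
    exact d.1.adj
  have hcard : ∀ d, ¬ M.Big d → (W.filter (G.Adj (M.src d))).card = 4 := fun d hd => by
    have e1 : minimalPeriod M.rot d = (W.filter (G.Adj (M.src d))).card := hper d
    have := M.four_le d
    unfold SparseMap.Big at hd
    omega
  have hlight : ∀ e, M.Pent e → M.bigCount e = 0 → ¬ M.Big e ∧ M.Pent (M.face e) ∧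
      M.bigCount (M.face e) = 0 := fun e he hb =>
    ⟨M.not_big_of_bigCount hb, M.pent_face.2 he, by rw [M.bigCount_face he, hb]⟩
  obtain ⟨b0, p1, c1⟩ := hlight d h1 h3
  obtain ⟨b1, p2, c2⟩ := hlight _ p1 c1
  obtain ⟨b2, p3, c3⟩ := hlight _ p2 c2
  obtain ⟨b3, p4, c4⟩ := hlight _ p3 c3
  obtain ⟨b4, -, -⟩ := hlight _ p4 c4
  have hpent : M.face (M.face (M.face (M.face (M.face d)))) = d := h1
  have htri : M.face (M.face (M.face (M.rev d))) = M.rev d := h2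
  refine ⟨![M.src d, M.src (M.face d), M.src (M.face (M.face d)),
    M.src (M.face (M.face (M.face d))), M.src (M.face (M.face (M.face (M.face d)))),
    M.src (M.face (M.face (M.rev d)))], ?_, ?_, hadj _, hadj _, hadj _, hadj _, ?_, ?_, ?_,
    (M.src_face_face_ne _).symm, (M.src_face_face_ne _).symm, (M.src_face_face_ne _).symm, ?_, ?_⟩
  · intro i
    fin_cases i <;> exact hsrc _
  · intro i
    fin_cases i
    exacts [hcard _ b0, hcard _ b1, hcard _ b2, hcard _ b3, hcard _ b4, hcard _ h5]
  · have := hadj (M.face (M.face (M.face (M.face d))))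
    rwa [hpent] at this
  · have := hadj (M.face (M.rev d))
    rwa [M.src_face, M.rev_rev] at this
  · have := hadj (M.face (M.face (M.rev d)))
    rw [htri, ← M.src_face] at this
    exact this.symm
  · have := M.src_face_face_ne (M.face (M.face (M.face d)))
    rw [hpent] at this
    exact this.symm
  · have := M.src_face_face_ne (M.face (M.face (M.face (M.face d))))
    rw [hpent] at this
    exact this.symm

end Light

end StrongChoice

namespace StrongChoice

/-! ### The upper bound -/

section Colouring

variable {V : Type*} {G : SimpleGraph V} {L : V → Finset ℤ} {b : ℕ}

/-- A `b`-fold colouring of the subgraph induced on `W` from the lists `L`. -/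
structure IsColouringOn (G : SimpleGraph V) (L : V → Finset ℤ) (b : ℕ) (W : Finset V)
    (S : V → Finset ℤ) : Prop where
  subset : ∀ v ∈ W, S v ⊆ L v
  card : ∀ v ∈ W, (S v).card = b
  disjoint : ∀ u ∈ W, ∀ v ∈ W, G.Adj u v → Disjoint (S u) (S v)

variable [DecidableEq V]

lemma IsColouringOn.extend {W : Finset V} {S : V → Finset ℤ} (hS : IsColouringOn G L b W S) {v : V}
    (hv : v ∉ W) {C : Finset ℤ} (hC : C ⊆ L v) (hCb : C.card = b)
    (hd : ∀ u ∈ W, G.Adj v u → Disjoint C (S u)) :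
    IsColouringOn G L b (insert v W) (Function.update S v C) := by
  have hne : ∀ u ∈ W, Function.update S v C u = S u := fun u hu =>
    Function.update_of_ne (by rintro rfl; exact hv hu) _ _
  refine ⟨?_, ?_, ?_⟩
  · intro u hu
    rcases Finset.mem_insert.1 hu with rfl | hu
    · rwa [Function.update_self]
    · rw [hne u hu]; exact hS.subset u hu
  · intro u hu
    rcases Finset.mem_insert.1 hu with rfl | hu
    · rwa [Function.update_self]
    · rw [hne u hu]; exact hS.card u hu
  · intro u hu w hw huw
    rcases Finset.mem_insert.1 hu with hu' | hu' <;> rcases Finset.mem_insert.1 hw with hw' | hw'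
    · exact absurd (hu'.trans hw'.symm) huw.ne
    · rw [hu', Function.update_self, hne w hw']; exact hd w hw' (hu' ▸ huw)
    · rw [hw', Function.update_self, hne u hu']; exact (hd u hu' (hw' ▸ huw.symm)).symm
    · rw [hne u hu', hne w hw']; exact hS.disjoint u hu' w hw' huw

variable [DecidableRel G.Adj]

/-- The colours of the list of `v` that no neighbour of `v` in `W` has received. -/
def freeColours (G : SimpleGraph V) [DecidableRel G.Adj] (L : V → Finset ℤ) (W : Finset V)
    (S : V → Finset ℤ) (v : V) : Finset ℤ :=
  L v \ (W.filter (G.Adj v)).biUnion S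

omit [DecidableEq V] in
lemma freeColours_subset {W : Finset V} {S : V → Finset ℤ} {v : V} :
    freeColours G L W S v ⊆ L v := Finset.sdiff_subset

omit [DecidableEq V] in
lemma disjoint_freeColours {W : Finset V} {S : V → Finset ℤ} {u v : V} {C : Finset ℤ}
    (hC : C ⊆ freeColours G L W S v) (hu : u ∈ W) (huv : G.Adj v u) : Disjoint C (S u) := by
  refine Finset.disjoint_of_subset_left hC (Finset.disjoint_left.2 fun c hc hcu => ?_)
  exact (Finset.mem_sdiff.1 hc).2
    (Finset.mem_biUnion.2 ⟨u, Finset.mem_filter.2 ⟨hu, huv⟩, hcu⟩)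

omit [DecidableEq V] in
lemma IsColouringOn.card_freeColours {W : Finset V} {S : V → Finset ℤ}
    (hS : IsColouringOn G L b W S) (v : V) :
    (L v).card ≤ (freeColours G L W S v).card + (W.filter (G.Adj v)).card * b := by
  have h1 : ((W.filter (G.Adj v)).biUnion S).card ≤ (W.filter (G.Adj v)).card * b :=
    Finset.card_biUnion_le_card_mul _ _ _ fun u hu => (hS.card u (Finset.mem_filter.1 hu).1).le
  have h2 := Finset.le_card_sdiff ((W.filter (G.Adj v)).biUnion S) (L v)
  unfold freeColours
  omega

lemma exists_subset_sdiff {A B : Finset ℤ} {b c : ℕ} (hA : b + c ≤ A.card) (hB : B.card ≤ c) :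
    ∃ C, C ⊆ A ∧ C.card = b ∧ Disjoint C B := by
  have h := Finset.le_card_sdiff B A
  obtain ⟨C, hC, hCb⟩ := Finset.exists_subset_card_eq (s := A \ B) (n := b) (by omega)
  exact ⟨C, hC.trans Finset.sdiff_subset, hCb,
    Finset.disjoint_of_subset_left hC Finset.sdiff_disjoint⟩

-- A chord of the pentagon, or an edge from the apex `v 5` to `v 2`, `v 3` or `v 4`, would close a
-- 4-cycle.
omit [DecidableEq V] [DecidableRel G.Adj] in
lemma LightConfiguration.not_adj [DecidableRel G.Adj] {W : Finset V} {v : Fin 6 → V}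
    (hv : LightConfiguration G W v)
    (h4 : ∀ a b c d, G.Adj a b → G.Adj b c → G.Adj c d → G.Adj d a → a = c ∨ b = d) :
    ¬ G.Adj (v 0) (v 2) ∧ ¬ G.Adj (v 0) (v 3) ∧ ¬ G.Adj (v 1) (v 3) ∧ ¬ G.Adj (v 1) (v 4) ∧
      ¬ G.Adj (v 2) (v 4) ∧ ¬ G.Adj (v 5) (v 2) ∧ ¬ G.Adj (v 5) (v 3) ∧ ¬ G.Adj (v 5) (v 4) := by
  obtain ⟨-, -, a01, a12, a23, a34, a40, a05, a15, n02, n13, n24, n30, n41⟩ := hv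
  refine ⟨fun h => ?_, fun h => ?_, fun h => ?_, fun h => ?_, fun h => ?_, fun h => ?_,
    fun h => ?_, fun h => ?_⟩
  · rcases h4 _ _ _ _ h a23 a34 a40 with k | k
    exacts [n30 k.symm, n24 k]
  · rcases h4 _ _ _ _ a01 a12 a23 h.symm with k | k
    exacts [n02 k, n13 k]
  · rcases h4 _ _ _ _ h a34 a40 a01 with k | k
    exacts [n41 k.symm, n30 k]
  · rcases h4 _ _ _ _ a12 a23 a34 h.symm with k | k
    exacts [n13 k, n24 k]
  · rcases h4 _ _ _ _ h a40 a01 a12 with k | k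
    exacts [n02 k.symm, n41 k]
  · rcases h4 _ _ _ _ h a12.symm a01.symm a05 with k | k
    exacts [a15.ne k.symm, n02 k.symm]
  · rcases h4 _ _ _ _ h a23.symm a12.symm a15 with k | k
    -- Here the 4-cycle degenerates: `v 5 = v 2` would make `v 0`, `v 2` a chord.
    · rw [k] at a05
      rcases h4 _ _ _ _ a05 a23 a34 a40 with l | l
      exacts [n30 l.symm, n24 l]
    · exact n13 k.symm
  · rcases h4 _ _ _ _ h a40 a01 a15 with k | k
    exacts [a05.ne k.symm, n41 k]

/-- After the rest is coloured, `v 0` and `v 1` keep `3 * b` colours and the other four keep `2 *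
b`. Colour `v 0` outside a set `X` of `2 * b` colours free at `v 5`, then go around the pentagon
through `v 4`, `v 3`, `v 2` to `v 1`. Finally `v 5` takes its colours from `X`, where only `v 1`
interferes. -/
lemma LightConfiguration.exists_colouring {W : Finset V} {v : Fin 6 → V}
    (hv : LightConfiguration G W v)
    (h4 : ∀ a b c d, G.Adj a b → G.Adj b c → G.Adj c d → G.Adj d a → a = c ∨ b = d)
    (hL : ∀ u, 4 * b ≤ (L u).card) {S : V → Finset ℤ}
    (hS : IsColouringOn G L b (W \ Finset.univ.image v) S) :
    ∃ S, IsColouringOn G L b W S := by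
  obtain ⟨n02, n03, n13, n14, n24, n52, n53, n54⟩ := hv.not_adj h4
  set U := W \ Finset.univ.image v with hU
  have hvU : ∀ i, v i ∉ U := fun i h =>
    (Finset.mem_sdiff.1 h).2 (Finset.mem_image_of_mem _ (Finset.mem_univ i))
  -- Of the four neighbours in `W`, those in the configuration are still uncoloured, and each saves
  -- `b` colours.
  have hfree : ∀ (i : Fin 6) (T : Finset (Fin 6)), (∀ j ∈ T, G.Adj (v i) (v j)) →
      (T.image v).card * b ≤ (freeColours G L U S (v i)).card := by
    intro i T hT
    have h1 : U.filter (G.Adj (v i)) ∪ T.image v ⊆ W.filter (G.Adj (v i)) := by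
      intro u hu
      rcases Finset.mem_union.1 hu with hu | hu
      · exact Finset.filter_subset_filter _ Finset.sdiff_subset hu
      · obtain ⟨j, hj, rfl⟩ := Finset.mem_image.1 hu
        exact Finset.mem_filter.2 ⟨hv.mem j, hT j hj⟩
    have h2 : Disjoint (U.filter (G.Adj (v i))) (T.image v) := by
      refine Finset.disjoint_left.2 fun u hu hu' => ?_
      obtain ⟨j, hj, rfl⟩ := Finset.mem_image.1 hu'
      exact hvU j (Finset.mem_filter.1 hu).1
    have h3 := Finset.card_le_card h1
    rw [Finset.card_union_of_disjoint h2, hv.card i] at h3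
    have h5 := hS.card_freeColours (v i)
    have h6 := hL (v i)
    have h7 := Nat.mul_le_mul_right b h3
    rw [add_mul] at h7
    omega
  obtain ⟨-, -, a01, a12, a23, a34, a40, a05, a15, d02, d13, d24, d30, d41⟩ := hv
  have d25 : v 2 ≠ v 5 := fun h => n02 (h ▸ a05)
  have d35 : v 3 ≠ v 5 := fun h => n03 (h ▸ a05)
  have d45 : v 4 ≠ v 5 := fun h => n14 (h ▸ a15)
  have f0 : 3 * b ≤ (freeColours G L U S (v 0)).card := by
    have := hfree 0 {1, 4, 5} (by simp [a01, a40.symm, a05])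
    rwa [Finset.image_insert, Finset.image_insert, Finset.image_singleton,
      Finset.card_eq_three.2 ⟨_, _, _, d41.symm, a15.ne, d45, rfl⟩] at this
  have f1 : 3 * b ≤ (freeColours G L U S (v 1)).card := by
    have := hfree 1 {0, 2, 5} (by simp [a01.symm, a12, a15])
    rwa [Finset.image_insert, Finset.image_insert, Finset.image_singleton,
      Finset.card_eq_three.2 ⟨_, _, _, d02, a05.ne, d25, rfl⟩] at this
  have f2 : 2 * b ≤ (freeColours G L U S (v 2)).card := by
    have := hfree 2 {1, 3} (by simp [a12.symm, a23])
    rwa [Finset.image_insert, Finset.image_singleton, Finset.card_pair d13] at this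
  have f3 : 2 * b ≤ (freeColours G L U S (v 3)).card := by
    have := hfree 3 {2, 4} (by simp [a23.symm, a34])
    rwa [Finset.image_insert, Finset.image_singleton, Finset.card_pair d24] at this
  have f4 : 2 * b ≤ (freeColours G L U S (v 4)).card := by
    have := hfree 4 {3, 0} (by simp [a34.symm, a40])
    rwa [Finset.image_insert, Finset.image_singleton, Finset.card_pair d30] at this
  have f5 : 2 * b ≤ (freeColours G L U S (v 5)).card := by
    have := hfree 5 {0, 1} (by simp [a05.symm, a15.symm])
    rwa [Finset.image_insert, Finset.image_singleton, Finset.card_pair a01.ne] at this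
  obtain ⟨X, hX, hXb⟩ := Finset.exists_subset_card_eq f5
  obtain ⟨C0, s0, c0, x0⟩ := exists_subset_sdiff (b := b) (c := 2 * b) (by omega) hXb.le
    (A := freeColours G L U S (v 0))
  obtain ⟨C4, s4, c4, x4⟩ := exists_subset_sdiff (b := b) (c := b) (by omega) c0.le
    (A := freeColours G L U S (v 4))
  obtain ⟨C3, s3, c3, x3⟩ := exists_subset_sdiff (b := b) (c := b) (by omega) c4.le
    (A := freeColours G L U S (v 3))
  obtain ⟨C2, s2, c2, x2⟩ := exists_subset_sdiff (b := b) (c := b) (by omega) c3.le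
    (A := freeColours G L U S (v 2))
  obtain ⟨C1, s1, c1, x1⟩ := exists_subset_sdiff (b := b) (c := 2 * b) (B := C0 ∪ C2) (by omega)
    (by have := Finset.card_union_le C0 C2; omega) (A := freeColours G L U S (v 1))
  obtain ⟨C5, s5, c5, x5⟩ := exists_subset_sdiff (b := b) (c := b) (by omega) c1.le (A := X)
  rw [Finset.disjoint_union_right] at x1
  have x50 : Disjoint C5 C0 := Finset.disjoint_of_subset_left s5 x0.symm
  have s5' := s5.trans hX
  have S0 := hS.extend (hvU 0) (s0.trans freeColours_subset) c0
    fun u hu hadj => disjoint_freeColours s0 hu hadj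
  have S4 := S0.extend (v := v 4) (C := C4) (by simp [hvU, a40.ne])
    (s4.trans freeColours_subset) c4 (by
      intro u hu hadj
      simp only [Finset.mem_insert] at hu
      rcases hu with rfl | hu
      · simpa using x4
      · have := disjoint_freeColours s4 hu hadj
        rwa [Function.update_of_ne (by rintro rfl; exact hvU _ hu)])
  have S3 := S4.extend (v := v 3) (C := C3) (by simp [hvU, a34.ne, d30])
    (s3.trans freeColours_subset) c3 (by
      intro u hu hadj
      simp only [Finset.mem_insert] at hu
      rcases hu with rfl | rfl | hu
      · simpa using x3
      · exact absurd hadj.symm n03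
      · have := disjoint_freeColours s3 hu hadj
        rwa [Function.update_of_ne (by rintro rfl; exact hvU _ hu),
          Function.update_of_ne (by rintro rfl; exact hvU _ hu)])
  have S2 := S3.extend (v := v 2) (C := C2) (by simp [hvU, a23.ne, d24, d02.symm])
    (s2.trans freeColours_subset) c2 (by
      intro u hu hadj
      simp only [Finset.mem_insert] at hu
      rcases hu with rfl | rfl | rfl | hu
      · simpa using x2
      · exact absurd hadj n24
      · exact absurd hadj.symm n02
      · have := disjoint_freeColours s2 hu hadj
        rwa [Function.update_of_ne (by rintro rfl; exact hvU _ hu),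
          Function.update_of_ne (by rintro rfl; exact hvU _ hu),
          Function.update_of_ne (by rintro rfl; exact hvU _ hu)])
  have S1 := S2.extend (v := v 1) (C := C1) (by simp [hvU, a12.ne, d13, d41.symm, a01.ne'])
    (s1.trans freeColours_subset) c1 (by
      intro u hu hadj
      simp only [Finset.mem_insert] at hu
      rcases hu with rfl | rfl | rfl | rfl | hu
      · simpa using x1.2
      · exact absurd hadj n13
      · exact absurd hadj n14
      · rw [Function.update_of_ne d02, Function.update_of_ne d30.symm,
          Function.update_of_ne a40.ne', Function.update_self]
        exact x1.1
      · have := disjoint_freeColours s1 hu hadj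
        rwa [Function.update_of_ne (by rintro rfl; exact hvU _ hu),
          Function.update_of_ne (by rintro rfl; exact hvU _ hu),
          Function.update_of_ne (by rintro rfl; exact hvU _ hu),
          Function.update_of_ne (by rintro rfl; exact hvU _ hu)])
  have S5 := S1.extend (v := v 5) (C := C5)
    (by simp [hvU, a15.ne', a05.ne', d25.symm, d35.symm, d45.symm])
    (s5'.trans freeColours_subset) c5 (by
      intro u hu hadj
      simp only [Finset.mem_insert] at hu
      rcases hu with rfl | rfl | rfl | rfl | rfl | hu
      · simpa using x5
      · exact absurd hadj n52
      · exact absurd hadj n53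
      · exact absurd hadj n54
      · rw [Function.update_of_ne a01.ne, Function.update_of_ne d02,
          Function.update_of_ne d30.symm, Function.update_of_ne a40.ne', Function.update_self]
        exact x50
      · have := disjoint_freeColours s5' hu hadj
        rwa [Function.update_of_ne (by rintro rfl; exact hvU _ hu),
          Function.update_of_ne (by rintro rfl; exact hvU _ hu),
          Function.update_of_ne (by rintro rfl; exact hvU _ hu),
          Function.update_of_ne (by rintro rfl; exact hvU _ hu),
          Function.update_of_ne (by rintro rfl; exact hvU _ hu)])
  have hW : ∀ u ∈ W, u ∈ insert (v 5) (insert (v 1) (insert (v 2) (insert (v 3)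
      (insert (v 4) (insert (v 0) U))))) := by
    intro u hu
    by_cases h : u ∈ Finset.univ.image v
    · obtain ⟨i, -, rfl⟩ := Finset.mem_image.1 h
      fin_cases i <;> simp
    · simp [hU, hu, h]
  exact ⟨_, fun u hu => S5.subset u (hW u hu), fun u hu => S5.card u (hW u hu),
    fun u hu w hw => S5.disjoint u (hW u hu) w (hW w hw)⟩

end Colouring

section UpperBound

variable {V : Type*} {G : SimpleGraph V} [Finite V]

lemma exists_isColouringOn [DecidableEq V] (hG : Planar G) (h4 : NoCycleOfLength G 4)
    {L : V → Finset ℤ} {b : ℕ} (hL : ∀ u, 4 * b ≤ (L u).card) (W : Finset V) :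
    ∃ S, IsColouringOn G L b W S := by
  classical
  induction W using Finset.strongInduction with
  | H W ih =>
  rcases W.eq_empty_or_nonempty with rfl | hne
  · exact ⟨fun _ => ∅, by simp, by simp, by simp⟩
  by_cases hdeg : ∀ v ∈ W, 4 ≤ (W.filter (G.Adj v)).card
  · obtain ⟨v, hv⟩ := exists_lightConfiguration hG h4 hne hdeg
    obtain ⟨S, hS⟩ := ih (W \ Finset.univ.image v) (Finset.sdiff_ssubset
      (fun u hu => by
        obtain ⟨i, -, rfl⟩ := Finset.mem_image.1 hu
        exact hv.mem i) ⟨v 0, Finset.mem_image_of_mem _ (Finset.mem_univ 0)⟩)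
    exact hv.exists_colouring (noCycleOfLength_four_iff.1 h4) hL hS
  · push Not at hdeg
    obtain ⟨v, hv, hlt⟩ := hdeg
    obtain ⟨S, hS⟩ := ih (W.erase v) (Finset.erase_ssubset hv)
    have h1 := hS.card_freeColours v
    have h2 := hL v
    have h3 : ((W.erase v).filter (G.Adj v)).card * b ≤ 3 * b := Nat.mul_le_mul_right b
      ((Finset.card_le_card (Finset.filter_subset_filter _ (Finset.erase_subset _ _))).trans
        (by omega))
    obtain ⟨C, hC, hCb⟩ := Finset.exists_subset_card_eq (s := freeColours G L (W.erase v) S v)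
      (n := b) (by omega)
    have := hS.extend (Finset.notMem_erase v W) (hC.trans freeColours_subset) hCb
      fun u hu hadj => disjoint_freeColours hC hu hadj
    rw [Finset.insert_erase hv] at this
    exact ⟨_, this⟩

theorem Planar.choosable (hG : Planar G) (h4 : NoCycleOfLength G 4) {a b : ℕ} (hab : 4 * b ≤ a) :
    Choosable G a b := by
  classical
  have := Fintype.ofFinite V
  intro L hL
  obtain ⟨S, hS⟩ := exists_isColouringOn hG h4 (fun u => hab.trans (hL u).ge) Finset.univ
  exact ⟨S, fun v => hS.subset v (Finset.mem_univ v), fun v => hS.card v (Finset.mem_univ v),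
    fun u v => hS.disjoint u (Finset.mem_univ u) v (Finset.mem_univ v)⟩

lemma strongFractionalChoiceNumber_le (hG : Planar G) (h4 : NoCycleOfLength G 4) :
    strongFractionalChoiceNumber G ≤ ((4 : ℝ) : EReal) := by
  refine sInf_le ⟨4, fun a b _ hb hab => ?_, rfl⟩
  rw [le_div_iff₀ (by exact_mod_cast hb)] at hab
  exact hG.choosable h4 (by exact_mod_cast hab)

end UpperBound

end StrongChoice

namespace StrongChoice

/-! ### The lower bound -/

/-- The vertices of the graph that consists of two terminals and, for each index in `ι`, a gadget
of two triangles `x y w` joined by an edge between the two vertices `w`. -/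
inductive GadgetVertex (ι : Type) : Type
  | top : GadgetVertex ι
  | bottom : GadgetVertex ι
  | x (i : ι) (b : Bool) : GadgetVertex ι
  | y (i : ι) (b : Bool) : GadgetVertex ι
  | w (i : ι) (b : Bool) : GadgetVertex ι

namespace GadgetVertex

variable {ι : Type}

/-- Adjacency: the terminal `top` is joined to all `x`, the terminal `bottom` to all `y`. -/
def Adj : GadgetVertex ι → GadgetVertex ι → Prop
  | top, x _ _ => True
  | x _ _, top => True
  | bottom, y _ _ => True
  | y _ _, bottom => True
  | x i b, y j c => i = j ∧ b = c
  | y i b, x j c => i = j ∧ b = c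
  | x i b, w j c => i = j ∧ b = c
  | w i b, x j c => i = j ∧ b = c
  | y i b, w j c => i = j ∧ b = c
  | w i b, y j c => i = j ∧ b = c
  | w i b, w j c => i = j ∧ b = !c
  | _, _ => False

/-- The graph of all gadgets, glued at the terminals. -/
def graph (ι : Type) : SimpleGraph (GadgetVertex ι) where
  Adj := Adj
  symm := ⟨fun a b h => by
    cases a <;> cases b <;> simp only [Adj] at h ⊢ <;> simp [h]⟩
  loopless := ⟨fun a h => by cases a <;> simp [Adj] at h⟩

lemma graph_adj {a b : GadgetVertex ι} : (graph ι).Adj a b ↔ Adj a b := Iff.rfl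

lemma adj_top (i : ι) (b : Bool) : (graph ι).Adj top (x i b) := trivial

lemma adj_bottom (i : ι) (b : Bool) : (graph ι).Adj bottom (y i b) := trivial

lemma graph_four_cycle (a b c d : GadgetVertex ι) (hab : (graph ι).Adj a b)
    (hbc : (graph ι).Adj b c) (hcd : (graph ι).Adj c d) (hda : (graph ι).Adj d a) :
    a = c ∨ b = d := by
  rw [graph_adj] at hab hbc hcd hda
  cases a <;> cases b <;> simp only [Adj] at hab <;> cases c <;> simp only [Adj] at hbc <;>
    cases d <;> simp only [Adj] at hcd hda <;>
    first | grind | simp_all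

lemma graph_preconnected [Nonempty ι] : (graph ι).Preconnected := by
  have h : ∀ a : GadgetVertex ι, (graph ι).Reachable top a := by
    have hx : ∀ i b, (graph ι).Reachable top (x i b) := fun i b =>
      SimpleGraph.Adj.reachable (show Adj top (x i b) from trivial)
    have hy : ∀ i b, (graph ι).Reachable top (y i b) := fun i b =>
      (hx i b).trans (SimpleGraph.Adj.reachable (show Adj (x i b) (y i b) from ⟨rfl, rfl⟩))
    rintro (_ | _ | ⟨i, b⟩ | ⟨i, b⟩ | ⟨i, b⟩)
    · exact SimpleGraph.Reachable.refl _
    · obtain ⟨i⟩ := ‹Nonempty ι›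
      exact (hy i true).trans (SimpleGraph.Adj.reachable (show Adj (y i true) bottom from trivial))
    · exact hx i b
    · exact hy i b
    · exact (hx i b).trans (SimpleGraph.Adj.reachable (show Adj (x i b) (w i b) from ⟨rfl, rfl⟩))
  exact fun a b => (h a).symm.trans (h b)

/-- The vertices as a sum type. -/
def equivSum (ι : Type) : GadgetVertex ι ≃ Bool ⊕ (Fin 3 × ι × Bool) where
  toFun
    | top => Sum.inl true
    | bottom => Sum.inl false
    | x i b => Sum.inr (0, i, b)
    | y i b => Sum.inr (1, i, b)
    | w i b => Sum.inr (2, i, b)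
  invFun
    | Sum.inl true => top
    | Sum.inl false => bottom
    | Sum.inr (0, i, b) => x i b
    | Sum.inr (1, i, b) => y i b
    | Sum.inr (2, i, b) => w i b
  left_inv a := by cases a <;> rfl
  right_inv a := by
    rcases a with (_ | _) | ⟨k, i, b⟩
    · rfl
    · rfl
    · fin_cases k <;> rfl

instance [Finite ι] : Finite (GadgetVertex ι) := Finite.of_equiv _ (equivSum ι).symm

lemma card_eq [Finite ι] : Nat.card (GadgetVertex ι) = 6 * Nat.card ι + 2 := by
  rw [Nat.card_congr (equivSum ι), Nat.card_sum, Nat.card_prod, Nat.card_prod]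
  simp
  ring

/-- The edges of the graph. -/
def edge : ι × Option (Bool × Fin 5) → Sym2 (GadgetVertex ι)
  | (i, none) => s(w i false, w i true)
  | (i, some (b, k)) => ![s(top, x i b), s(bottom, y i b), s(x i b, y i b), s(x i b, w i b),
      s(y i b, w i b)] k

/-- Five edges for each of the two triangles and one between the vertices `w`. An upper bound
suffices for planarity, since Euler's inequality supplies the other direction. -/
lemma card_edgeSet_le [Finite ι] : Nat.card (graph ι).edgeSet ≤ 11 * Nat.card ι := by
  have h : (graph ι).edgeSet ⊆ Set.range (edge (ι := ι)) := by
    intro e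
    induction e using Sym2.ind with
    | _ a b =>
    intro h
    have h : Adj a b := h
    rcases a with _ | _ | ⟨i, b₁⟩ | ⟨i, b₁⟩ | ⟨i, b₁⟩ <;>
      rcases b with _ | _ | ⟨j, b₂⟩ | ⟨j, b₂⟩ | ⟨j, b₂⟩ <;> simp only [Adj] at h
    · exact ⟨(j, some (b₂, 0)), rfl⟩
    · exact ⟨(j, some (b₂, 1)), rfl⟩
    · exact ⟨(i, some (b₁, 0)), Sym2.eq_swap⟩
    · obtain ⟨rfl, rfl⟩ := h
      exact ⟨(i, some (b₁, 2)), rfl⟩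
    · obtain ⟨rfl, rfl⟩ := h
      exact ⟨(i, some (b₁, 3)), rfl⟩
    · exact ⟨(i, some (b₁, 1)), Sym2.eq_swap⟩
    · obtain ⟨rfl, rfl⟩ := h
      exact ⟨(i, some (b₁, 2)), Sym2.eq_swap⟩
    · obtain ⟨rfl, rfl⟩ := h
      exact ⟨(i, some (b₁, 4)), rfl⟩
    · obtain ⟨rfl, rfl⟩ := h
      exact ⟨(i, some (b₁, 3)), Sym2.eq_swap⟩
    · obtain ⟨rfl, rfl⟩ := h
      exact ⟨(i, some (b₁, 4)), Sym2.eq_swap⟩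
    · obtain ⟨rfl, rfl⟩ := h
      cases b₂
      · exact ⟨(i, none), Sym2.eq_swap⟩
      · exact ⟨(i, none), rfl⟩
  rw [Nat.card_coe_set_eq]
  refine (Set.ncard_le_ncard h (Set.toFinite _)).trans ?_
  rw [← Set.image_univ]
  refine (Set.ncard_image_le (Set.toFinite _)).trans ?_
  rw [Set.ncard_univ, Nat.card_prod, Finite.card_option, Nat.card_prod]
  simp
  linarith

/-! ### A plane rotation system for the gadget graph -/

section Rotation

variable {n : ℕ}

/-- The neighbour of the first vertex that follows the second one in counterclockwise order. -/
def succAt : GadgetVertex (Fin (n + 1)) → GadgetVertex (Fin (n + 1)) → GadgetVertex (Fin (n + 1))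
  | top, x i false => x i true
  | top, x i true => x (i + 1) false
  | bottom, y i true => y i false
  | bottom, y i false => y (i - 1) true
  | x i false, top => y i false
  | x i false, y _ _ => w i false
  | x i true, top => w i true
  | x i true, w _ _ => y i true
  | x _ _, _ => top
  | y i false, w _ _ => x i false
  | y i false, bottom => w i false
  | y i true, x _ _ => w i true
  | y i true, bottom => x i true
  | y _ _, _ => bottom
  | w i b, w _ _ => if b then y i true else x i false
  | w i b, x _ _ => if b then w i false else y i false
  | w i b, y _ _ => if b then x i true else w i true
  | _, a => a

/-- The neighbour of the first vertex that precedes the second one in counterclockwise order. -/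
def predAt : GadgetVertex (Fin (n + 1)) → GadgetVertex (Fin (n + 1)) → GadgetVertex (Fin (n + 1))
  | top, x i true => x i false
  | top, x i false => x (i - 1) true
  | bottom, y i false => y i true
  | bottom, y i true => y (i + 1) false
  | x _ false, y _ _ => top
  | x i false, w _ _ => y i false
  | x _ true, w _ _ => top
  | x i true, y _ _ => w i true
  | x i b, top => if b then y i true else w i false
  | y i false, x _ _ => w i false
  | y _ false, w _ _ => bottom
  | y i true, w _ _ => x i true
  | y _ true, x _ _ => bottom
  | y i b, bottom => if b then w i true else x i false
  | w i b, y _ _ => if b then w i false else x i false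
  | w i b, x _ _ => if b then y i true else w i true
  | w i b, w _ _ => if b then x i true else y i false
  | _, a => a

lemma adj_succAt {a b : GadgetVertex (Fin (n + 1))} (h : Adj a b) : Adj a (succAt a b) := by
  rcases a with _ | _ | ⟨i, _ | _⟩ | ⟨i, _ | _⟩ | ⟨i, _ | _⟩ <;>
    rcases b with _ | _ | ⟨j, _ | _⟩ | ⟨j, _ | _⟩ | ⟨j, _ | _⟩ <;> simp_all [Adj, succAt]

lemma adj_predAt {a b : GadgetVertex (Fin (n + 1))} (h : Adj a b) : Adj a (predAt a b) := by
  rcases a with _ | _ | ⟨i, _ | _⟩ | ⟨i, _ | _⟩ | ⟨i, _ | _⟩ <;>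
    rcases b with _ | _ | ⟨j, _ | _⟩ | ⟨j, _ | _⟩ | ⟨j, _ | _⟩ <;> simp_all [Adj, predAt]

lemma predAt_succAt {a b : GadgetVertex (Fin (n + 1))} (h : Adj a b) :
    predAt a (succAt a b) = b := by
  rcases a with _ | _ | ⟨i, _ | _⟩ | ⟨i, _ | _⟩ | ⟨i, _ | _⟩ <;>
    rcases b with _ | _ | ⟨j, _ | _⟩ | ⟨j, _ | _⟩ | ⟨j, _ | _⟩ <;>
    simp_all [Adj, succAt, predAt]

lemma succAt_predAt {a b : GadgetVertex (Fin (n + 1))} (h : Adj a b) :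
    succAt a (predAt a b) = b := by
  rcases a with _ | _ | ⟨i, _ | _⟩ | ⟨i, _ | _⟩ | ⟨i, _ | _⟩ <;>
    rcases b with _ | _ | ⟨j, _ | _⟩ | ⟨j, _ | _⟩ | ⟨j, _ | _⟩ <;>
    simp_all [Adj, succAt, predAt]

/-- The rotation of the darts. -/
def rotation (n : ℕ) : Equiv.Perm (graph (Fin (n + 1))).Dart where
  toFun d := ⟨(d.fst, succAt d.fst d.snd), adj_succAt d.adj⟩
  invFun d := ⟨(d.fst, predAt d.fst d.snd), adj_predAt d.adj⟩
  left_inv d := SimpleGraph.Dart.ext _ _ (Prod.ext rfl (predAt_succAt d.adj))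
  right_inv d := SimpleGraph.Dart.ext _ _ (Prod.ext rfl (succAt_predAt d.adj))

/-- Vertices other than the terminals have degree 3, so any two neighbours are consecutive in the
rotation. -/
lemma succAt_of_ne_terminal {a b c : GadgetVertex (Fin (n + 1))} (h : a ≠ top) (h' : a ≠ bottom)
    (hb : Adj a b) (hc : Adj a c) : b = c ∨ succAt a b = c ∨ succAt a c = b := by
  rcases a with _ | _ | ⟨i, _ | _⟩ | ⟨i, _ | _⟩ | ⟨i, _ | _⟩
  · exact absurd rfl h
  · exact absurd rfl h'
  all_goals
    cases b <;> simp only [Adj] at hb <;> cases c <;> simp only [Adj] at hc <;>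
      simp_all [succAt]

open Equiv.Perm in
lemma sameCycle_rotation {a b c : GadgetVertex (Fin (n + 1))} (hb : (graph (Fin (n + 1))).Adj a b)
    (hc : (graph (Fin (n + 1))).Adj a c) :
    SameCycle (rotation n) ⟨(a, b), hb⟩ ⟨(a, c), hc⟩ := by
  have step : ∀ {a b c : GadgetVertex (Fin (n + 1))} (hb : (graph (Fin (n + 1))).Adj a b)
      (hc : (graph (Fin (n + 1))).Adj a c), succAt a b = c →
      SameCycle (rotation n) ⟨(a, b), hb⟩ ⟨(a, c), hc⟩ := by
    intro a b c hb hc h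
    have : (⟨(a, c), hc⟩ : (graph (Fin (n + 1))).Dart) = rotation n ⟨(a, b), hb⟩ :=
      SimpleGraph.Dart.ext _ _ (Prod.ext rfl h.symm)
    rw [this]
    exact sameCycle_apply_right.2 (SameCycle.refl _ _)
  have htop : ∀ i b, SameCycle (rotation n) ⟨(top, x 0 false), adj_top _ _⟩
      ⟨(top, x i b), adj_top _ _⟩ := by
    have h0 : ∀ i, SameCycle (rotation n) ⟨(top, x 0 false), adj_top _ _⟩
        ⟨(top, x i false), adj_top _ _⟩ := by
      intro i
      induction i using Fin.induction with
      | zero => exact SameCycle.refl _ _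
      | succ i ih =>
        refine ih.trans ((step (adj_top _ _) (adj_top i.castSucc true) rfl).trans
          (step (adj_top _ _) (adj_top _ _) ?_))
        rw [← Fin.coeSucc_eq_succ]
        rfl
    rintro i (_ | _)
    · exact h0 i
    · exact (h0 i).trans (step (adj_top _ _) (adj_top _ _) rfl)
  have hbot : ∀ i b, SameCycle (rotation n) ⟨(bottom, y 0 true), adj_bottom _ _⟩
      ⟨(bottom, y i b), adj_bottom _ _⟩ := by
    have h0 : ∀ i, SameCycle (rotation n) ⟨(bottom, y 0 true), adj_bottom _ _⟩
        ⟨(bottom, y i true), adj_bottom _ _⟩ := by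
      intro i
      induction i using Fin.induction with
      | zero => exact SameCycle.refl _ _
      | succ i ih =>
        refine ih.trans (SameCycle.symm ((step (adj_bottom _ _)
          (adj_bottom i.succ false) rfl).trans (step (adj_bottom _ _) (adj_bottom _ _) ?_)))
        rw [← Fin.coeSucc_eq_succ, succAt, add_sub_cancel_right]
    rintro i (_ | _)
    · exact (h0 i).trans (step (adj_bottom _ _) (adj_bottom _ _) rfl)
    · exact h0 i
  by_cases ha : a = top
  · subst ha
    rw [graph_adj] at hb hc
    rcases b with _ | _ | ⟨j, b⟩ | ⟨j, b⟩ | ⟨j, b⟩ <;> simp only [Adj] at hb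
    rcases c with _ | _ | ⟨k, c⟩ | ⟨k, c⟩ | ⟨k, c⟩ <;> simp only [Adj] at hc
    exact (htop j b).symm.trans (htop k c)
  by_cases ha' : a = bottom
  · subst ha'
    rw [graph_adj] at hb hc
    rcases b with _ | _ | ⟨j, b⟩ | ⟨j, b⟩ | ⟨j, b⟩ <;> simp only [Adj] at hb
    rcases c with _ | _ | ⟨k, c⟩ | ⟨k, c⟩ | ⟨k, c⟩ <;> simp only [Adj] at hc
    exact (hbot j b).symm.trans (hbot k c)
  rcases succAt_of_ne_terminal ha ha' hb hc with h | h | h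
  · subst h; exact SameCycle.refl _ _
  · exact step hb hc h
  · exact (step hc hb h).symm

/-- The planar embedding. -/
def rotationSystem (n : ℕ) : RotationSystem (graph (Fin (n + 1))) where
  next := rotation n
  fst_next _ := rfl
  sameCycle := by
    rintro ⟨⟨a, b⟩, h⟩ ⟨⟨a', b'⟩, h'⟩ rfl
    exact sameCycle_rotation h h'

/-- The face to which a dart belongs. -/
def faceLabel : GadgetVertex (Fin (n + 1)) → GadgetVertex (Fin (n + 1)) → Fin (n + 1) × Fin 5
  | top, x i b => if b then (i, 3) else (i, 0)
  | bottom, y i b => if b then (i + 1, 0) else (i, 4)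
  | x i b, top => if b then (i + 1, 0) else (i, 3)
  | x i b, y _ _ => if b then (i, 2) else (i, 0)
  | x i b, w _ _ => if b then (i, 3) else (i, 1)
  | y i b, bottom => if b then (i, 4) else (i, 0)
  | y i b, x _ _ => if b then (i + 1, 0) else (i, 1)
  | y i b, w _ _ => if b then (i, 2) else (i, 4)
  | w i b, x _ _ => if b then (i, 2) else (i, 3)
  | w i b, y _ _ => if b then (i, 4) else (i, 1)
  | w i b, w _ _ => if b then (i, 3) else (i, 4)
  | _, _ => (0, 0)

lemma faceLabel_succAt {a b : GadgetVertex (Fin (n + 1))} (h : Adj a b) :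
    faceLabel b (succAt b a) = faceLabel a b := by
  rcases a with _ | _ | ⟨i, _ | _⟩ | ⟨i, _ | _⟩ | ⟨i, _ | _⟩ <;>
    rcases b with _ | _ | ⟨j, _ | _⟩ | ⟨j, _ | _⟩ | ⟨j, _ | _⟩ <;>
    simp_all [Adj, succAt, faceLabel]

/-- The labels are constant along faces and all of them occur. For each gadget, labels 1 and 2 are
its triangles, 3 and 4 the pentagons at `top` and `bottom`, and 0 the hexagon shared with the
preceding gadget. -/
lemma five_mul_le_card_face : 5 * (n + 1) ≤ Nat.card (rotationSystem n).Face := by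
  rw [(rotationSystem n).card_face, mul_comm]
  have hinv : cycles ((rotationSystem n).next * dartReversal _) ≤
      Setoid.ker fun d : (graph (Fin (n + 1))).Dart => faceLabel d.fst d.snd :=
    cycles_le_iff.2 fun d => (faceLabel_succAt d.adj).symm
  have hsurj : Function.Surjective (Quotient.lift
      (fun d : (graph (Fin (n + 1))).Dart => faceLabel d.fst d.snd) fun a b h => hinv h) := by
    rintro ⟨i, k⟩
    fin_cases k
    · exact ⟨Quotient.mk _ ⟨(top, x i false), trivial⟩, rfl⟩
    · exact ⟨Quotient.mk _ ⟨(x i false, w i false), rfl, rfl⟩, rfl⟩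
    · exact ⟨Quotient.mk _ ⟨(x i true, y i true), rfl, rfl⟩, rfl⟩
    · exact ⟨Quotient.mk _ ⟨(top, x i true), trivial⟩, rfl⟩
    · exact ⟨Quotient.mk _ ⟨(bottom, y i false), trivial⟩, rfl⟩
  have := Nat.card_le_card_of_surjective _ hsurj
  rw [Nat.card_prod, Nat.card_eq_fintype_card, Nat.card_eq_fintype_card, Fintype.card_fin,
    Fintype.card_fin] at this
  exact this.trans (Nat.le_add_right _ _)

/-- For `N` gadgets, `(6 N + 2) + 5 N = 11 N + 2`. -/
theorem planar_graph (n : ℕ) : Planar (graph (Fin (n + 1))) := by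
  refine ⟨rotationSystem n, le_antisymm (rotationSystem n).euler_le ?_⟩
  have h1 := card_eq (ι := Fin (n + 1))
  have h2 := card_edgeSet_le (ι := Fin (n + 1))
  have h3 := five_mul_le_card_face (n := n)
  have h4 : Nat.card (graph (Fin (n + 1))).ConnectedComponent ≤ 1 :=
    Finite.card_le_one_iff_subsingleton.2
      graph_preconnected.subsingleton_connectedComponent
  rw [Nat.card_fin] at h1 h2
  omega

end Rotation

end GadgetVertex

end StrongChoice

/-! ### Lists without a colouring, and the resulting bounds -/

namespace StrongChoice

namespace GadgetVertex

/-- The lists of the vertices: `A` for the terminals, `X` and `M` for the gadgets, and the sets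
`p i` that are meant for the terminals in the gadget with index `i`. -/
def lists {ι : Type} (A X M : Finset ℤ) (p : ι → Finset ℤ × Finset ℤ) :
    GadgetVertex ι → Finset ℤ
  | top => A
  | bottom => A
  | x i _ => (p i).1 ∪ X
  | y i _ => (p i).2 ∪ X
  | w _ _ => X ∪ M

/-- In a triangle of a gadget, the vertex `w` takes many colours from `M`. -/
lemma card_le_card_inter {A B C X M : Finset ℤ} {m k : ℕ} (hX : X.card = 2 * m + k)
    (hA : A.card = m) (hB : B.card = m) (hC : C.card = m) (hAX : A ⊆ X) (hBX : B ⊆ X)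
    (hCX : C ⊆ X ∪ M) (hAB : Disjoint A B) (hAC : Disjoint A C) (hBC : Disjoint B C) :
    m ≤ (C ∩ M).card + k := by
  have h1 : (A ∪ B ∪ C ∩ X).card ≤ X.card :=
    Finset.card_le_card (Finset.union_subset (Finset.union_subset hAX hBX)
      Finset.inter_subset_right)
  have h2 : Disjoint (A ∪ B) (C ∩ X) :=
    Finset.disjoint_of_subset_right Finset.inter_subset_left
      (Finset.disjoint_union_left.2 ⟨hAC, hBC⟩)
  rw [Finset.card_union_of_disjoint h2, Finset.card_union_of_disjoint hAB] at h1
  have h3 : C.card ≤ (C ∩ X).card + (C ∩ M).card := by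
    rw [← Finset.inter_eq_left.2 hCX, Finset.inter_union_distrib_left]
    refine (Finset.card_union_le _ _).trans (le_of_eq ?_)
    rw [← Finset.inter_union_distrib_left, Finset.inter_eq_left.2 hCX]
  omega

/-- Consider the gadget indexed by the colours that the terminals actually receive. Its `x` and `y`
must be coloured from `X`; each triangle then leaves only `k` colours of `X` for `w`, which takes at
least `m - k` colours from `M`. The two `w` are adjacent and `M` has `m` colours, so `2 * (m - k) ≤
m`, contrary to `2 * k < m`. -/
theorem exists_not_choosable {m k : ℕ} (hk : 2 * k < m) :
    ∃ n, ¬ Choosable (graph (Fin (n + 1))) (3 * m + k) m := by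
  set A : Finset ℤ := Finset.Ico 0 (3 * m + k : ℕ) with hA
  set X : Finset ℤ := Finset.Ico (3 * m + k : ℕ) (5 * m + 2 * k : ℕ) with hX
  set M : Finset ℤ := Finset.Ico (5 * m + 2 * k : ℕ) (6 * m + 2 * k : ℕ) with hM
  have cA : A.card = 3 * m + k := by rw [hA, Int.card_Ico]; omega
  have cX : X.card = 2 * m + k := by rw [hX, Int.card_Ico]; omega
  have cM : M.card = m := by rw [hM, Int.card_Ico]; omega
  have dAX : Disjoint A X := Finset.disjoint_left.2 fun c hc hc' => by
    rw [hA, Finset.mem_Ico] at hc; rw [hX, Finset.mem_Ico] at hc'; omega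
  have dXM : Disjoint X M := Finset.disjoint_left.2 fun c hc hc' => by
    rw [hX, Finset.mem_Ico] at hc; rw [hM, Finset.mem_Ico] at hc'; omega
  set P := A.powersetCard m ×ˢ A.powersetCard m with hP
  have hmem : ∀ q, q ∈ P ↔ (q.1 ⊆ A ∧ q.1.card = m) ∧ (q.2 ⊆ A ∧ q.2.card = m) := fun q => by
    rw [hP, Finset.mem_product, Finset.mem_powersetCard, Finset.mem_powersetCard]
  have hPpos : P.card ≠ 0 := by
    rw [hP, Finset.card_product, Finset.card_powersetCard, cA]
    have := Nat.choose_pos (show m ≤ 3 * m + k by omega)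
    positivity
  obtain ⟨n, hn⟩ := Nat.exists_eq_succ_of_ne_zero hPpos
  let e := P.equivFinOfCardEq hn
  let p : Fin (n + 1) → Finset ℤ × Finset ℤ := fun i => (e.symm i).1
  have hp : ∀ i, ((p i).1 ⊆ A ∧ (p i).1.card = m) ∧ ((p i).2 ⊆ A ∧ (p i).2.card = m) := fun i =>
    (hmem _).1 (e.symm i).2
  have hsurj : ∀ S T : Finset ℤ, S ⊆ A → S.card = m → T ⊆ A → T.card = m → ∃ i, p i = (S, T) := by
    intro S T hS hS' hT hT'
    have : (S, T) ∈ P := (hmem _).2 ⟨⟨hS, hS'⟩, hT, hT'⟩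
    exact ⟨e ⟨(S, T), this⟩, by simp [p]⟩
  refine ⟨n, fun hch => ?_⟩
  obtain ⟨S, hS, hSm, hd⟩ := hch (lists A X M p) (by
    rintro (_ | _ | ⟨i, b⟩ | ⟨i, b⟩ | ⟨i, b⟩)
    · exact cA
    · exact cA
    · rw [lists, Finset.card_union_of_disjoint (Finset.disjoint_of_subset_left (hp i).1.1 dAX),
        (hp i).1.2, cX]
      ring
    · rw [lists, Finset.card_union_of_disjoint (Finset.disjoint_of_subset_left (hp i).2.1 dAX),
        (hp i).2.2, cX]
      ring
    · rw [lists, Finset.card_union_of_disjoint dXM, cX, cM]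
      ring)
  obtain ⟨i, hi⟩ := hsurj (S top) (S bottom) (hS top) (hSm top) (hS bottom) (hSm bottom)
  have hx : ∀ b, S (x i b) ⊆ X := fun b => by
    have h1 : S (x i b) ⊆ (p i).1 ∪ X := hS (x i b)
    rw [hi] at h1
    exact (hd (x i b) top trivial).left_le_of_le_sup_left h1
  have hy : ∀ b, S (y i b) ⊆ X := fun b => by
    have h1 : S (y i b) ⊆ (p i).2 ∪ X := hS (y i b)
    rw [hi] at h1
    exact (hd (y i b) bottom trivial).left_le_of_le_sup_left h1
  have hw : ∀ b, m ≤ (S (w i b) ∩ M).card + k := fun b =>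
    card_le_card_inter cX (hSm (x i b)) (hSm (y i b)) (hSm (w i b)) (hx b) (hy b) (hS (w i b))
      (hd _ _ ⟨rfl, rfl⟩) (hd _ _ ⟨rfl, rfl⟩) (hd _ _ ⟨rfl, rfl⟩)
  have hww : Disjoint (S (w i false) ∩ M) (S (w i true) ∩ M) :=
    Finset.disjoint_of_subset_left Finset.inter_subset_left
      (Finset.disjoint_of_subset_right Finset.inter_subset_left (hd _ _ ⟨rfl, rfl⟩))
  have h1 : (S (w i false) ∩ M ∪ S (w i true) ∩ M).card ≤ M.card :=
    Finset.card_le_card (Finset.union_subset Finset.inter_subset_right Finset.inter_subset_right)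
  rw [Finset.card_union_of_disjoint hww, cM] at h1
  have h2 := hw false
  have h3 := hw true
  omega

end GadgetVertex

lemma exists_planar_not_choosable (m : ℕ) (hm : 0 < m) :
    ∃ G ∈ planarWithoutCycle 4, ¬ Choosable G.graph (3 * m + (m - 1) / 2) m := by
  obtain ⟨n, hn⟩ := GadgetVertex.exists_not_choosable (m := m) (k := (m - 1) / 2) (by omega)
  exact ⟨⟨GadgetVertex (Fin (n + 1)), GadgetVertex.graph (Fin (n + 1))⟩,
    ⟨GadgetVertex.planar_graph n,
      noCycleOfLength_four_iff.2 fun a b c d => GadgetVertex.graph_four_cycle a b c d⟩, hn⟩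

lemma le_strongFractionalChoiceNumber {V : Type*} {G : SimpleGraph V} {a b : ℕ} (ha : 0 < a)
    (hb : 0 < b) (h : ¬ Choosable G a b) :
    (((a : ℝ) / b : ℝ) : EReal) ≤ strongFractionalChoiceNumber G := by
  refine le_sInf ?_
  rintro _ ⟨r, hr, rfl⟩
  refine EReal.coe_le_coe_iff.2 (le_of_not_gt fun hlt => h (hr a b ha hb hlt.le))

/-- For `m = 2 * t + 1` the floor is `t`, and `(3 m + t) / m = 7/2 - 1 / (2 m)`. -/
lemma le_familyStrongFractionalChoiceNumber (t : ℕ) :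
    ((7 / 2 - 1 / (2 * (2 * t + 1)) : ℝ) : EReal) ≤
      familyStrongFractionalChoiceNumber (planarWithoutCycle 4) := by
  obtain ⟨G, hG, hn⟩ := exists_planar_not_choosable (2 * t + 1) (by omega)
  have h := le_strongFractionalChoiceNumber (by omega) (by omega) hn
  refine le_trans (le_of_eq ?_) (h.trans (le_sSup (Set.mem_image_of_mem _ hG)))
  rw [show (2 * t + 1 - 1) / 2 = t by omega]
  congr 1
  push_cast
  field_simp
  ring

end StrongChoice

theorem proposition5p2 :
    (∀ m : ℕ, 0 < m → ∃ G ∈ StrongChoice.planarWithoutCycle 4,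
      ¬ StrongChoice.Choosable G.graph (3 * m + (m - 1) / 2) m) ∧
    ((3 + 1 / 2 : ℝ) : EReal) ≤
      StrongChoice.familyStrongFractionalChoiceNumber (StrongChoice.planarWithoutCycle 4) ∧
    StrongChoice.familyStrongFractionalChoiceNumber (StrongChoice.planarWithoutCycle 4) ≤
      ((4 : ℝ) : EReal) := by
  refine ⟨StrongChoice.exists_planar_not_choosable, ?_, ?_⟩
  · by_contra hlt
    obtain ⟨q, hq, hq'⟩ := EReal.lt_iff_exists_real_btwn.1 (not_le.1 hlt)
    have hq' : q < 3 + 1 / 2 := EReal.coe_lt_coe_iff.1 hq'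
    obtain ⟨t, ht⟩ := exists_nat_gt (1 / (3 + 1 / 2 - q))
    have h := EReal.coe_lt_coe_iff.1
      ((StrongChoice.le_familyStrongFractionalChoiceNumber t).trans_lt hq)
    have hpos : 0 < 3 + 1 / 2 - q := by linarith
    rw [div_lt_iff₀ hpos] at ht
    have h2 : 1 / (2 * (2 * (t : ℝ) + 1)) < 3 + 1 / 2 - q := by
      rw [div_lt_iff₀ (by positivity)]
      nlinarith
    linarith
  · refine sSup_le ?_
    rintro _ ⟨G, hG, rfl⟩
    exact StrongChoice.strongFractionalChoiceNumber_le hG.1 hG.2
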